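/- Let $\mathbb{H}\cong\mathbb{R}^4$ be the quaternions, let $\mathbb{S}$ be the set of $I\in\mathbb{H}$ with zero real part and $|I|=1$, and let $m$ be Lebesgue measure on $\mathbb{R}^4$. A function $f:\mathbb{H}\to\mathbb{H}$ is entire slice regular if it is real differentiable and $\frac12\big(\frac{\partial}{\partial x}+I\frac{\partial}{\partial y}\big)f(x+Iy)=0$ for all $I\in\mathbb{S}$ and $x,y\in\mathbb{R}$. For $\alpha>0$ and $0<p<\infty$, the Fock space of the first kind $\mathcal{F}^p_\alpha(\mathbb{H})$ is the set of all entire slice regular $f$ with $$\|f\|_{p,\alpha}^p:=\Big(\frac{\alpha p}{2\pi}\Big)^2\int_{\mathbb{H}}|f(q)|^p\big(e^{-\alpha|q|^2/2}\big)^p\,dm(q)<\infty .$$ A quaternionic polynomial is a function $q\mapsto\sum_{k=0}^n q^k a_k$ with $n\in\mathbb{N}$ and $a_0,\dots,a_n\in\mathbb{H}$. Theorem. Let $\alpha>0$ and $0<p<\infty$. Every quaternionic polynomial belongs to $\mathcal{F}^p_\alpha(\mathbb{H})$, and for every $f\in\mathcal{F}^p_\alpha(\mathbb{H})$ there is a sequence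 of quaternionic polynomials $(p_n)_{n\in\mathbb{N}}$ with $\|p_n-f\|_{p,\alpha}\to0$ as $n\to\infty$. -/

import Mathlib

open scoped Quaternion ENNReal Topology
open MeasureTheory Filter

/-- The Borel σ-algebra of `ℍ`. With it, Mathlib's `volume` on the inner product space `ℍ` is
the Lebesgue measure of `ℝ⁴` (see `measurePreserving_linearIsometryEquivTuple`). -/
noncomputable instance Quaternion.instMeasurableSpaceBorel : MeasurableSpace ℍ := borel ℍ

instance Quaternion.instBorelSpace : BorelSpace ℍ := ⟨rfl⟩

namespace SliceFock

theorem measurePreserving_linearIsometryEquivTuple :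
    MeasurePreserving Quaternion.linearIsometryEquivTuple
      (volume : Measure ℍ) (volume : Measure (EuclideanSpace ℝ (Fin 4))) :=
  Quaternion.linearIsometryEquivTuple.measurePreserving

/-- The sphere `𝕊` of purely imaginary unit quaternions. -/
def imagSphere : Set ℍ := {I | I.re = 0 ∧ ‖I‖ = 1}

/-- The point `x + I y` of the slice `ℂ_I`. -/
noncomputable def slicePoint (I : ℍ) (x y : ℝ) : ℍ := (x : ℍ) + I * (y : ℍ)

/-- The operator `½ (∂/∂x + I ∂/∂y)` applied to the restriction of `f` to `ℂ_I`, at `x + I y`. -/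
noncomputable def sliceDbar (f : ℍ → ℍ) (I : ℍ) (x y : ℝ) : ℍ :=
  (1 / 2 : ℝ) • (deriv (fun t : ℝ => f (slicePoint I t y)) x
    + I * deriv (fun t : ℝ => f (slicePoint I x t)) y)

/-- Entire (left) slice regular functions. -/
def IsEntireSliceRegular (f : ℍ → ℍ) : Prop :=
  Differentiable ℝ f ∧ ∀ I ∈ imagSphere, ∀ x y : ℝ, sliceDbar f I x y = 0

/-- `(αp/2π)² ∫_ℍ |f(q)|^p (e^{-α|q|²/2})^p dm(q)`, with values in `[0, ∞]`. -/
noncomputable def fockNormPow (p α : ℝ) (f : ℍ → ℍ) : ℝ≥0∞ :=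
  ENNReal.ofReal ((α * p / (2 * Real.pi)) ^ 2) *
    ∫⁻ q : ℍ, ENNReal.ofReal (‖f q‖ ^ p * (Real.exp (-α * ‖q‖ ^ 2 / 2)) ^ p)

/-- The (quasi-)norm `‖f‖_{p,α}`, with values in `[0, ∞]`. -/
noncomputable def fockNorm (p α : ℝ) (f : ℍ → ℍ) : ℝ≥0∞ := fockNormPow p α f ^ (1 / p)

/-- The slice regular Fock space of the first kind. -/
def fockSpace (p α : ℝ) : Set (ℍ → ℍ) :=
  {f | IsEntireSliceRegular f ∧ fockNormPow p α f < ∞}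

/-- The functions `q ↦ ∑_{k ≤ n} q^k a_k`, with quaternionic coefficients on the right. -/
def quaternionicPolynomials : Set (ℍ → ℍ) :=
  {P | ∃ (n : ℕ) (a : ℕ → ℍ), ∀ q : ℍ, P q = ∑ k ∈ Finset.range (n + 1), q ^ k * a k}

end SliceFock

/-! Two approximations are composed: `f` by its dilates `f (r • q)` with `r < 1`, and each dilate by
its Taylor polynomials.

Dilation multiplies the `p`-th power integral by at most `r⁻⁴`, and the dilates converge to `f`
pointwise. Pointwise convergence together with this control of the norms forces convergence in mean,
by a Brezis–Lieb argument that needs no convexity and so covers every `p > 0`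
(`tendsto_lintegral_of_tendsto_of_lintegral_le`).

For the Taylor polynomials the key is the pointwise bound `|f| ≤ C exp (β |q|² / 2)` on one slice,
for every `β > α`. Cauchy's estimates then bound the coefficients, and for a dilate all partial sums
lie under one Gaussian of exponent strictly below `α`. Dominated convergence finishes.

To get the growth bound, `f` is viewed on a slice `ℂ_I` as a holomorphic function into `ℍ`. Lebesgue
measure on `ℍ` becomes `y² dx dy dσ(I)` in the coordinates `x + I y`, and the representation formula
compares all slices with a fixed one. So the slice function has a finite Gaussian integral with the
extra weight `y²`. This weight vanishes on the real axis, so the usual mean value inequality has to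
be replaced by one adapted to it (`ofReal_pow_mul_norm_le_lintegral_ball`). -/

namespace SliceFock

/-! ### A mean value inequality with the weight `(Im w)²`. -/

section OneVariable

variable {E : Type*} [NormedAddCommGroup E] [NormedSpace ℂ E] [CompleteSpace E]

theorem norm_sq_sub_sq_circleMap {r : ℝ} (hr : 0 ≤ r) (θ : ℝ) :
    ‖(r : ℂ) ^ 2 - circleMap 0 r θ ^ 2‖ = 2 * r ^ 2 * |Real.sin θ| := by
  have h : (r : ℂ) ^ 2 - circleMap 0 r θ ^ 2
      = circleMap 0 r θ * ((-2 * r * Real.sin θ : ℝ) * Complex.I) := by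
    rw [circleMap_zero, Complex.exp_mul_I, ← Complex.ofReal_cos, ← Complex.ofReal_sin]
    apply Complex.ext
    · simp [pow_two, Complex.sin_ofReal_re, Complex.cos_ofReal_re]
      have := Real.sin_sq_add_cos_sq θ
      linear_combination (-r ^ 2) * this
    · simp [pow_two]
      ring
  rw [h, norm_mul, norm_mul, Complex.norm_I, Complex.norm_real, norm_circleMap_zero]
  simp only [Real.norm_eq_abs, abs_mul, abs_neg, abs_two, abs_of_nonneg hr]
  ring

/-- Cauchy's formula is applied to `(r² - w²)² F(w)` instead of `F`. On the circle `|w| = r` the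
factor has modulus `(2 r Im w)²`, which produces the weight; at `z` it is at least `r² (r - |z|)²`.
The Cauchy kernel costs the third power of `r - |z|`. -/
theorem pow_mul_norm_le_integral_circle {F : ℂ → E} (hF : Differentiable ℂ F) {r : ℝ} {z : ℂ}
    (hz : ‖z‖ < r) :
    (r - ‖z‖) ^ 3 * ‖F z‖ ≤
      2 / Real.pi * ∫ θ in (0 : ℝ)..(2 * Real.pi),
        r * ((r * Real.sin θ) ^ 2 * ‖F (circleMap 0 r θ)‖) := by
  have hr : 0 < r := (norm_nonneg z).trans_lt hz
  have hd : 0 < r - ‖z‖ := sub_pos.2 hz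
  set g : ℂ → E := fun w => ((r : ℂ) ^ 2 - w ^ 2) ^ 2 • F w with hg
  have hgd : Differentiable ℂ g := by
    rw [hg]; fun_prop
  have hcauchy := hgd.diffContOnCl.circleIntegral_sub_inv_smul (c := 0) (R := r) (w := z)
    (by simpa using hz)
  have hlow : r ^ 2 * (r - ‖z‖) ^ 2 * ‖F z‖ ≤ ‖g z‖ := by
    simp only [hg, norm_smul, norm_pow]
    have h1 : r * (r - ‖z‖) ≤ ‖(r : ℂ) ^ 2 - z ^ 2‖ := by
      have := norm_sub_norm_le ((r : ℂ) ^ 2) (z ^ 2)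
      simp only [norm_pow, Complex.norm_real, Real.norm_eq_abs, abs_of_pos hr] at this
      nlinarith [norm_nonneg z]
    have h2 := pow_le_pow_left₀ (by positivity) h1 2
    rw [mul_pow] at h2
    gcongr
  have hup : ‖∮ w in C(0, r), (w - z)⁻¹ • g w‖ ≤
      ∫ θ in (0 : ℝ)..(2 * Real.pi),
        4 * r ^ 2 / (r - ‖z‖) * (r * ((r * Real.sin θ) ^ 2 * ‖F (circleMap 0 r θ)‖)) := by
    rw [circleIntegral]
    have hcF : Continuous fun θ => F (circleMap 0 r θ) :=
      hF.continuous.comp (continuous_circleMap 0 r)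
    refine intervalIntegral.norm_integral_le_of_norm_le Real.two_pi_pos.le
      (Eventually.of_forall fun θ _ => ?_) ?_
    · rw [deriv_circleMap, norm_smul, norm_mul, Complex.norm_I, norm_circleMap_zero, norm_smul,
        norm_inv, hg, norm_smul, norm_pow, norm_sq_sub_sq_circleMap hr.le, abs_of_pos hr, mul_pow,
        sq_abs]
      have h1 : ‖circleMap 0 r θ - z‖⁻¹ ≤ (r - ‖z‖)⁻¹ := by
        apply inv_anti₀ hd
        have := norm_sub_norm_le (circleMap 0 r θ) z
        rwa [norm_circleMap_zero, abs_of_pos hr] at this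
      calc _ ≤ r * 1 * ((r - ‖z‖)⁻¹ * ((2 * r ^ 2) ^ 2 * Real.sin θ ^ 2 *
              ‖F (circleMap 0 r θ)‖)) := by gcongr
        _ = _ := by field_simp; ring
    · refine Continuous.intervalIntegrable (continuous_const.mul (continuous_const.mul ?_)) _ _
      exact ((continuous_const.mul Real.continuous_sin).pow 2).mul hcF.norm
  rw [hcauchy, norm_smul, intervalIntegral.integral_const_mul] at hup
  set J := ∫ θ in (0 : ℝ)..(2 * Real.pi), r * ((r * Real.sin θ) ^ 2 * ‖F (circleMap 0 r θ)‖)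
  have h2pi : ‖(2 * Real.pi * Complex.I : ℂ)‖ = 2 * Real.pi := by
    simp [abs_of_pos Real.pi_pos]
  rw [h2pi] at hup
  have hpi := Real.pi_pos
  have h3 : 2 * Real.pi * (r ^ 2 * (r - ‖z‖) ^ 2 * ‖F z‖) ≤ 4 * r ^ 2 / (r - ‖z‖) * J :=
    (mul_le_mul_of_nonneg_left hlow (by positivity)).trans hup
  rw [div_mul_eq_mul_div, le_div_iff₀ hd] at h3
  rw [div_mul_eq_mul_div, le_div_iff₀ hpi]
  have h4 : (2 * r ^ 2) * ((r - ‖z‖) ^ 3 * ‖F z‖ * Real.pi) ≤ (2 * r ^ 2) * (2 * J) := by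
    linarith
  exact le_of_mul_le_mul_left h4 (by positivity)

theorem ofReal_pow_mul_norm_le_lintegral_circle {F : ℂ → E} (hF : Differentiable ℂ F) {r : ℝ}
    {z : ℂ} (hz : ‖z‖ < r) :
    ENNReal.ofReal ((r - ‖z‖) ^ 3 * ‖F z‖) ≤
      ENNReal.ofReal (2 / Real.pi) * ∫⁻ θ in Set.Ioo (-Real.pi) Real.pi,
        ENNReal.ofReal r * ENNReal.ofReal ((Complex.polarCoord.symm (r, θ)).im ^ 2 *
          ‖F (Complex.polarCoord.symm (r, θ))‖) := by
  have hr : 0 < r := (norm_nonneg z).trans_lt hz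
  set u : ℝ → ℝ := fun θ => r * ((r * Real.sin θ) ^ 2 * ‖F (circleMap 0 r θ)‖) with hu
  have hcF : Continuous fun θ => F (circleMap 0 r θ) :=
    hF.continuous.comp (continuous_circleMap 0 r)
  have hcu : Continuous u :=
    continuous_const.mul (((continuous_const.mul Real.continuous_sin).pow 2).mul hcF.norm)
  have hper : Function.Periodic u (2 * Real.pi) := fun θ => by
    simp only [hu, Real.sin_add_two_pi, periodic_circleMap 0 r θ]
  have h1 := hper.intervalIntegral_add_eq 0 (-Real.pi)
  rw [zero_add, show -Real.pi + 2 * Real.pi = Real.pi by ring] at h1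
  have h2 := pow_mul_norm_le_integral_circle hF hz
  rw [h1] at h2
  refine (ENNReal.ofReal_le_ofReal h2).trans ?_
  rw [ENNReal.ofReal_mul (by positivity),
    intervalIntegral.integral_of_le (by linarith [Real.pi_pos]),
    integral_Ioc_eq_integral_Ioo, ofReal_integral_eq_lintegral_ofReal]
  · gcongr with θ
    rw [← ENNReal.ofReal_mul hr.le]
    have hp : Complex.polarCoord.symm (r, θ) = circleMap 0 r θ := by
      rw [Complex.polarCoord_symm_apply, circleMap_zero, Complex.exp_mul_I]
      simp
    have him : (circleMap 0 r θ).im = r * Real.sin θ := by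
      rw [circleMap_zero, Complex.exp_mul_I, ← Complex.ofReal_cos, ← Complex.ofReal_sin]
      simp [Complex.sin_ofReal_re]
    rw [hp, him]
  · exact (hcu.integrableOn_Icc).mono_set Set.Ioo_subset_Icc_self
  · exact Eventually.of_forall fun θ => by positivity

/-- A mean value inequality for entire functions, with respect to the area measure weighted by
the square of the distance to the real axis. -/
theorem ofReal_pow_mul_norm_le_lintegral_ball {F : ℂ → E} (hF : Differentiable ℂ F) {R : ℝ}
    {z : ℂ} (hz : ‖z‖ < R) :
    ENNReal.ofReal ((R - ‖z‖) ^ 4 * ‖F z‖) ≤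
      ENNReal.ofReal 4 * (ENNReal.ofReal (2 / Real.pi) * ∫⁻ w in Metric.ball 0 R,
        ENNReal.ofReal (w.im ^ 2 * ‖F w‖)) := by
  have hFc := hF.continuous
  -- Cutting off outside the ball lets the radial integral over `(‖z‖, R)` be enlarged to all of
  -- `(0, ∞)`, where polar coordinates on `ℂ` apply.
  set v : ℂ → ℝ≥0∞ := (Metric.ball 0 R).indicator fun w => ENNReal.ofReal (w.im ^ 2 * ‖F w‖)
    with hv
  have hvm : Measurable v := by
    refine Measurable.indicator ?_ measurableSet_ball
    fun_prop
  have h0 : ∀ r ∈ Set.Ioo ‖z‖ R, ENNReal.ofReal ((r - ‖z‖) ^ 3 * ‖F z‖) ≤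
      ENNReal.ofReal (2 / Real.pi) * ∫⁻ θ in Set.Ioo (-Real.pi) Real.pi,
        ENNReal.ofReal r * v (Complex.polarCoord.symm (r, θ)) := fun r hr => by
    refine (ofReal_pow_mul_norm_le_lintegral_circle hF hr.1).trans_eq ?_
    have hr0 : 0 < r := (norm_nonneg z).trans_lt hr.1
    congr 2 with θ
    rw [hv, Set.indicator_of_mem]
    rw [mem_ball_zero_iff, Complex.norm_polarCoord_symm, abs_of_pos hr0]
    exact hr.2
  have h1 : ENNReal.ofReal ((R - ‖z‖) ^ 4 / 4 * ‖F z‖) =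
      ∫⁻ r in Set.Ioo ‖z‖ R, ENNReal.ofReal ((r - ‖z‖) ^ 3 * ‖F z‖) := by
    rw [← ofReal_integral_eq_lintegral_ofReal, ← integral_Ioc_eq_integral_Ioo,
      ← intervalIntegral.integral_of_le hz.le, intervalIntegral.integral_mul_const,
      intervalIntegral.integral_comp_sub_right (fun x => x ^ 3), integral_pow]
    · norm_num
    · refine Continuous.integrableOn_Icc (a := ‖z‖) (b := R) ?_ |>.mono_set Set.Ioo_subset_Icc_self
      fun_prop
    · refine (ae_restrict_iff' measurableSet_Ioo).2 (Eventually.of_forall fun r hr => ?_)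
      have : 0 < r - ‖z‖ := sub_pos.2 hr.1
      positivity
  have hm : Measurable fun q : ℝ × ℝ => ENNReal.ofReal q.1 * v (Complex.polarCoord.symm q) := by
    have : Continuous fun q : ℝ × ℝ => Complex.polarCoord.symm q := by
      simp only [Complex.polarCoord_symm_apply]
      fun_prop
    exact (by fun_prop : Measurable fun q : ℝ × ℝ => ENNReal.ofReal q.1).mul
      (hvm.comp this.measurable)
  have h2 : ∫⁻ r in Set.Ioo ‖z‖ R, ENNReal.ofReal ((r - ‖z‖) ^ 3 * ‖F z‖) ≤
      ENNReal.ofReal (2 / Real.pi) * ∫⁻ w, v w := by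
    calc _ ≤ ∫⁻ r in Set.Ioo ‖z‖ R, ENNReal.ofReal (2 / Real.pi) *
          ∫⁻ θ in Set.Ioo (-Real.pi) Real.pi,
            ENNReal.ofReal r * v (Complex.polarCoord.symm (r, θ)) :=
          setLIntegral_mono' measurableSet_Ioo h0
      _ ≤ ∫⁻ r in Set.Ioi (0 : ℝ), ENNReal.ofReal (2 / Real.pi) *
          ∫⁻ θ in Set.Ioo (-Real.pi) Real.pi,
            ENNReal.ofReal r * v (Complex.polarCoord.symm (r, θ)) :=
          lintegral_mono_set fun r hr => (norm_nonneg z).trans_lt hr.1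
      _ = ENNReal.ofReal (2 / Real.pi) * ∫⁻ w, v w := by
          rw [lintegral_const_mul' _ _ ENNReal.ofReal_ne_top,
            ← Complex.lintegral_comp_polarCoord_symm, polarCoord_target, Measure.volume_eq_prod]
          simp only [smul_eq_mul]
          rw [setLIntegral_prod _ hm.aemeasurable]
  rw [← h1, hv, lintegral_indicator measurableSet_ball] at h2
  calc _ = ENNReal.ofReal 4 * ENNReal.ofReal ((R - ‖z‖) ^ 4 / 4 * ‖F z‖) := by
        rw [← ENNReal.ofReal_mul (by norm_num)]
        congr 1
        ring
    _ ≤ _ := by gcongr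

end OneVariable

/-! ### Pointwise growth from the weighted Gaussian integral. -/

section Growth

variable {E : Type*} [NormedAddCommGroup E] [NormedSpace ℂ E] [CompleteSpace E]

/-- The mean value inequality is linear in `‖F‖`, whereas only `‖F‖ ^ p` is controlled. The
hypothesis `hab` trades one for the other; the two exponent ranges supply `a` and `b` differently.
-/
theorem pow_mul_norm_le_of_norm_le_add_mul_rpow {F : ℂ → E} (hF : Differentiable ℂ F)
    {p α A : ℝ} (hp : 0 < p) (hα : 0 < α) (hA : 0 ≤ A)
    (hInt : ∫⁻ w : ℂ, ENNReal.ofReal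
      (w.im ^ 2 * (‖F w‖ ^ p * (Real.exp (-α * ‖w‖ ^ 2 / 2)) ^ p)) ≤ ENNReal.ofReal A)
    {a b R : ℝ} (ha : 0 ≤ a) (hb : 0 ≤ b)
    (hab : ∀ w ∈ Metric.ball (0 : ℂ) R, ‖F w‖ ≤ a + b * ‖F w‖ ^ p) {z : ℂ} (hz : ‖z‖ < R) :
    (R - ‖z‖) ^ 4 * ‖F z‖ ≤
      8 / Real.pi * (a * (Real.pi * R ^ 4) + b * (Real.exp (α * R ^ 2 / 2) ^ p * A)) := by
  have hR : 0 < R := (norm_nonneg z).trans_lt hz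
  have hFc := hF.continuous
  have hpi := Real.pi_pos
  set T := Real.exp (α * R ^ 2 / 2) ^ p with hT
  have hT0 : 0 < T := by positivity
  have hpt : ∀ w ∈ Metric.ball (0 : ℂ) R, ENNReal.ofReal (w.im ^ 2 * ‖F w‖) ≤
      ENNReal.ofReal (a * R ^ 2) + ENNReal.ofReal (b * T) * ENNReal.ofReal
        (w.im ^ 2 * (‖F w‖ ^ p * (Real.exp (-α * ‖w‖ ^ 2 / 2)) ^ p)) := fun w hw => by
    rw [← ENNReal.ofReal_mul (by positivity), ← ENNReal.ofReal_add (by positivity) (by positivity)]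
    apply ENNReal.ofReal_le_ofReal
    have hwR : ‖w‖ < R := by simpa using hw
    have him : w.im ^ 2 ≤ R ^ 2 := by
      rw [← sq_abs]
      exact pow_le_pow_left₀ (abs_nonneg _) ((Complex.abs_im_le_norm w).trans hwR.le) 2
    -- Inside the ball the Gaussian weight can be inserted at the cost of its smallest value, `1 /
    -- T`.
    have h1 : 1 ≤ T * Real.exp (-α * ‖w‖ ^ 2 / 2) ^ p := by
      rw [hT, ← Real.mul_rpow (by positivity) (by positivity), ← Real.exp_add]
      apply Real.one_le_rpow _ hp.le
      apply Real.one_le_exp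
      have : ‖w‖ ^ 2 ≤ R ^ 2 := by gcongr
      nlinarith
    calc w.im ^ 2 * ‖F w‖ ≤ w.im ^ 2 * (a + b * ‖F w‖ ^ p) := by gcongr; exact hab w hw
      _ = w.im ^ 2 * a + w.im ^ 2 * b * ‖F w‖ ^ p * 1 := by ring
      _ ≤ R ^ 2 * a + w.im ^ 2 * b * ‖F w‖ ^ p * (T * Real.exp (-α * ‖w‖ ^ 2 / 2) ^ p) := by
          gcongr
      _ = _ := by ring
  have hball : volume (Metric.ball (0 : ℂ) R) = ENNReal.ofReal (Real.pi * R ^ 2) := by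
    rw [Complex.volume_ball, mul_comm, ENNReal.ofReal_mul hpi.le, ENNReal.ofReal_pow hR.le]
    congr 1
    exact (ENNReal.ofReal_coe_nnreal (p := NNReal.pi)).symm
  have hlin : ∫⁻ w in Metric.ball 0 R, ENNReal.ofReal (w.im ^ 2 * ‖F w‖) ≤
      ENNReal.ofReal (a * (Real.pi * R ^ 4) + b * (T * A)) := by
    calc _ ≤ ∫⁻ w in Metric.ball 0 R, (ENNReal.ofReal (a * R ^ 2) + ENNReal.ofReal (b * T) *
          ENNReal.ofReal (w.im ^ 2 * (‖F w‖ ^ p * (Real.exp (-α * ‖w‖ ^ 2 / 2)) ^ p))) :=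
          setLIntegral_mono' measurableSet_ball hpt
      _ ≤ ENNReal.ofReal (a * R ^ 2) * ENNReal.ofReal (Real.pi * R ^ 2) +
          ENNReal.ofReal (b * T) * ENNReal.ofReal A := by
          rw [lintegral_add_left measurable_const, lintegral_const,
            Measure.restrict_apply_univ, hball, lintegral_const_mul' _ _ ENNReal.ofReal_ne_top]
          gcongr
          exact (setLIntegral_le_lintegral _ _).trans hInt
      _ = _ := by
          rw [← ENNReal.ofReal_mul (by positivity), ← ENNReal.ofReal_mul (by positivity),
            ← ENNReal.ofReal_add (by positivity) (by positivity)]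
          congr 1
          ring
  have hmain := (ofReal_pow_mul_norm_le_lintegral_ball hF hz).trans
    (mul_le_mul_right (mul_le_mul_right hlin _) _)
  rw [← ENNReal.ofReal_mul (by positivity), ← ENNReal.ofReal_mul (by positivity),
    ENNReal.ofReal_le_ofReal_iff (by positivity)] at hmain
  refine hmain.trans_eq ?_
  ring

theorem exists_norm_le_of_one_le {F : ℂ → E} (hF : Differentiable ℂ F)
    {p α A : ℝ} (hp : 1 ≤ p) (hα : 0 < α) (hA : 0 ≤ A)
    (hInt : ∫⁻ w : ℂ, ENNReal.ofReal
      (w.im ^ 2 * (‖F w‖ ^ p * (Real.exp (-α * ‖w‖ ^ 2 / 2)) ^ p)) ≤ ENNReal.ofReal A) :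
    ∃ C, 0 ≤ C ∧ ∀ z, ‖F z‖ ≤ C * ((‖z‖ + 1) ^ 4 * Real.exp (α * (‖z‖ + 1) ^ 2 / 2)) := by
  have hpi := Real.pi_pos
  refine ⟨8 / Real.pi * (Real.pi + A), by positivity, fun z => ?_⟩
  set R := ‖z‖ + 1 with hR
  have hR1 : 1 ≤ R := by simp [hR]
  set T := Real.exp (α * R ^ 2 / 2) with hT
  have hT0 : 0 < T := by positivity
  -- Split at the height `T`: where `‖F w‖ > T`, the nonpositive power `‖F w‖ ^ (1 - p)` is at most
  -- `T ^ (1 - p)`. This height makes both resulting terms proportional to `T`.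
  have h := pow_mul_norm_le_of_norm_le_add_mul_rpow hF (by linarith) hα hA hInt
    (a := T) (b := T ^ (1 - p)) (R := R) hT0.le (by positivity) (fun w _ => ?_) (z := z)
    (by simp [hR])
  · rw [← hT, ← mul_assoc (T ^ (1 - p)), ← Real.rpow_add hT0, sub_add_cancel, Real.rpow_one,
      show R - ‖z‖ = 1 by simp [hR], one_pow, one_mul] at h
    refine h.trans ?_
    have : T * A ≤ T * A * R ^ 4 := le_mul_of_one_le_right (by positivity) (one_le_pow₀ hR1)
    calc _ ≤ 8 / Real.pi * (T * (Real.pi * R ^ 4) + T * A * R ^ 4) := by gcongr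
      _ = _ := by ring
  · rcases le_or_gt ‖F w‖ T with hle | hgt
    · have : 0 ≤ T ^ (1 - p) * ‖F w‖ ^ p := by positivity
      linarith
    · have hw0 : 0 < ‖F w‖ := hT0.trans hgt
      have h1 : ‖F w‖ ^ (1 - p) ≤ T ^ (1 - p) :=
        Real.rpow_le_rpow_of_nonpos hT0 hgt.le (by linarith)
      calc ‖F w‖ = ‖F w‖ ^ (1 - p) * ‖F w‖ ^ p := by
            rw [← Real.rpow_add hw0, sub_add_cancel, Real.rpow_one]
        _ ≤ T ^ (1 - p) * ‖F w‖ ^ p := by gcongr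
        _ ≤ _ := by linarith

/-- For `p < 1` the surplus factor `‖F‖ ^ (1 - p)` is bounded by `F` itself: at a maximum point `z₀`
of `(R - ‖w‖) ^ κ * ‖F w‖`, nearby values are at most `2 ^ κ ‖F z₀‖`, and the factor `‖F z₀‖ ^ (1 -
p)` cancels from the mean value inequality at `z₀`. -/
theorem exists_norm_le_of_lt_one {F : ℂ → E} (hF : Differentiable ℂ F)
    {p α A : ℝ} (hp : 0 < p) (hp1 : p < 1) (hα : 0 < α) (hA : 0 ≤ A)
    (hInt : ∫⁻ w : ℂ, ENNReal.ofReal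
      (w.im ^ 2 * (‖F w‖ ^ p * (Real.exp (-α * ‖w‖ ^ 2 / 2)) ^ p)) ≤ ENNReal.ofReal A) :
    ∃ C, 0 ≤ C ∧ ∀ z, ‖F z‖ ≤ C * ((‖z‖ + 1) ^ 4 * Real.exp (α * (‖z‖ + 1) ^ 2 / 2)) := by
  have hpi := Real.pi_pos
  -- Chosen so that the `p`-th power of `(R - ‖z₀‖) ^ κ` is the factor `(R - ‖z₀‖) ^ 4` of the mean
  -- value inequality.
  set κ := 4 / p with hκ
  have hκ0 : 0 < κ := by positivity
  set B := 16 * (8 / Real.pi) * ((2 : ℝ) ^ κ) ^ (1 - p) * A with hB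
  have hB0 : 0 ≤ B := by positivity
  refine ⟨B ^ (1 / p), by positivity, fun z => ?_⟩
  set R := ‖z‖ + 1 with hR
  have hR1 : 1 ≤ R := by simp [hR]
  set T := Real.exp (α * R ^ 2 / 2) with hT
  have hT0 : 0 < T := by positivity
  rcases eq_or_ne (F z) 0 with hz0 | hz0
  · rw [hz0, norm_zero]; positivity
  have hφc : ContinuousOn (fun w : ℂ => (R - ‖w‖) ^ κ * ‖F w‖) (Metric.closedBall 0 R) := by
    have := hF.continuous
    refine Continuous.continuousOn (Continuous.mul ?_ (by fun_prop))
    exact (by fun_prop : Continuous fun w : ℂ => R - ‖w‖).rpow_const fun _ => Or.inr hκ0.le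
  obtain ⟨z₀, hz₀, hmax⟩ := (isCompact_closedBall (0 : ℂ) R).exists_isMaxOn
    ⟨0, by simp; linarith⟩ hφc
  have hmax' : ∀ w : ℂ, ‖w‖ ≤ R → (R - ‖w‖) ^ κ * ‖F w‖ ≤ (R - ‖z₀‖) ^ κ * ‖F z₀‖ :=
    fun w hw => hmax (by simpa using hw)
  have hFz : ‖F z‖ ≤ (R - ‖z₀‖) ^ κ * ‖F z₀‖ := by
    simpa [hR] using hmax' z (by simp [hR])
  have hpos : 0 < (R - ‖z₀‖) ^ κ * ‖F z₀‖ := (norm_pos_iff.2 hz0).trans_le hFz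
  have hd0 : 0 ≤ R - ‖z₀‖ := sub_nonneg.2 (by simpa using hz₀)
  have hF0 : 0 < ‖F z₀‖ := pos_of_mul_pos_right hpos (by positivity)
  have hd : 0 < R - ‖z₀‖ := by
    refine hd0.lt_of_ne fun h => ?_
    rw [← h, Real.zero_rpow hκ0.ne', zero_mul] at hpos
    exact lt_irrefl _ hpos
  -- Half way to the boundary: `R - ‖w‖` stays at least `(R - ‖z₀‖) / 2` on this ball, and halving
  -- the gap at `z₀` costs the factor `16 = 2⁴` in `B`.
  set R' := (‖z₀‖ + R) / 2 with hR'
  have hloc : ∀ w ∈ Metric.ball (0 : ℂ) R', ‖F w‖ ≤ 2 ^ κ * ‖F z₀‖ := fun w hw => by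
    have hw' : ‖w‖ < R' := by simpa using hw
    have h1 : (R - ‖z₀‖) / 2 ≤ R - ‖w‖ := by linarith
    have h2 : ((R - ‖z₀‖) / 2) ^ κ * ‖F w‖ ≤ (R - ‖z₀‖) ^ κ * ‖F z₀‖ :=
      (mul_le_mul_of_nonneg_right (Real.rpow_le_rpow (by linarith) h1 hκ0.le)
        (norm_nonneg _)).trans (hmax' w (by linarith))
    rw [Real.div_rpow hd.le (by norm_num), div_mul_eq_mul_div, div_le_iff₀ (by positivity)] at h2
    have h3 : (R - ‖z₀‖) ^ κ * ‖F w‖ ≤ (R - ‖z₀‖) ^ κ * (2 ^ κ * ‖F z₀‖) := by linarith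
    exact le_of_mul_le_mul_left h3 (by positivity)
  have h := pow_mul_norm_le_of_norm_le_add_mul_rpow hF hp hα hA hInt
    (a := 0) (b := (2 ^ κ * ‖F z₀‖) ^ (1 - p)) (R := R') le_rfl (by positivity) (fun w hw => ?_)
    (z := z₀) (by linarith)
  · have hT' : Real.exp (α * R' ^ 2 / 2) ^ p ≤ T ^ p := by
      have h1 : R' ^ 2 ≤ R ^ 2 := pow_le_pow_left₀ (by positivity) (by linarith) 2
      apply Real.rpow_le_rpow (by positivity) _ hp.le
      apply Real.exp_le_exp.2
      gcongr
    have h1 : (R - ‖z₀‖) ^ 4 * ‖F z₀‖ ≤ 16 * (8 / Real.pi *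
        ((2 ^ κ) ^ (1 - p) * ‖F z₀‖ ^ (1 - p) * (T ^ p * A))) := by
      rw [← Real.mul_rpow (by positivity) (by positivity)]
      calc _ = 16 * ((R' - ‖z₀‖) ^ 4 * ‖F z₀‖) := by rw [hR']; ring
        _ ≤ 16 * (8 / Real.pi * (0 * (Real.pi * R' ^ 4) + (2 ^ κ * ‖F z₀‖) ^ (1 - p) *
            (Real.exp (α * R' ^ 2 / 2) ^ p * A))) := by gcongr
        _ ≤ 16 * (8 / Real.pi * (0 * (Real.pi * R' ^ 4) + (2 ^ κ * ‖F z₀‖) ^ (1 - p) *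
            (T ^ p * A))) := by gcongr
        _ = _ := by ring
    have h2 : (R - ‖z₀‖) ^ 4 * ‖F z₀‖ ^ p ≤ B * T ^ p := by
      have h3 : ‖F z₀‖ = ‖F z₀‖ ^ (1 - p) * ‖F z₀‖ ^ p := by
        rw [← Real.rpow_add hF0, sub_add_cancel, Real.rpow_one]
      have h4 : ‖F z₀‖ ^ (1 - p) * ((R - ‖z₀‖) ^ 4 * ‖F z₀‖ ^ p) ≤
          ‖F z₀‖ ^ (1 - p) * (B * T ^ p) := by
        calc _ = (R - ‖z₀‖) ^ 4 * (‖F z₀‖ ^ (1 - p) * ‖F z₀‖ ^ p) := by ring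
          _ = (R - ‖z₀‖) ^ 4 * ‖F z₀‖ := by rw [← h3]
          _ ≤ _ := h1
          _ = _ := by rw [hB]; ring
      exact le_of_mul_le_mul_left h4 (by positivity)
    have h5 : ‖F z‖ ^ p ≤ B * T ^ p := by
      refine (Real.rpow_le_rpow (norm_nonneg _) hFz hp.le).trans ?_
      rw [Real.mul_rpow (by positivity) (by positivity), ← Real.rpow_mul hd.le, hκ,
        div_mul_cancel₀ _ hp.ne']
      exact_mod_cast h2
    have h6 := Real.rpow_le_rpow (by positivity) h5 (z := 1 / p) (by positivity)
    rw [← Real.rpow_mul (by positivity), Real.mul_rpow hB0 (by positivity),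
      ← Real.rpow_mul hT0.le, mul_one_div_cancel hp.ne', Real.rpow_one, Real.rpow_one] at h6
    refine h6.trans ?_
    gcongr
    exact le_mul_of_one_le_left hT0.le (one_le_pow₀ hR1)
  · rw [zero_add]
    rcases (norm_nonneg (F w)).eq_or_lt with h0 | h0
    · rw [← h0]; positivity
    · calc ‖F w‖ = ‖F w‖ ^ (1 - p) * ‖F w‖ ^ p := by
            rw [← Real.rpow_add h0, sub_add_cancel, Real.rpow_one]
        _ ≤ _ := by
          have h1 := Real.rpow_le_rpow h0.le (hloc w hw) (z := 1 - p) (by linarith)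
          gcongr

theorem exists_norm_le_mul_exp {F : ℂ → E} (hF : Differentiable ℂ F)
    {p α β : ℝ} (hp : 0 < p) (hα : 0 < α) (hβ : α < β)
    (hInt : ∫⁻ w : ℂ, ENNReal.ofReal
      (w.im ^ 2 * (‖F w‖ ^ p * (Real.exp (-α * ‖w‖ ^ 2 / 2)) ^ p)) < ∞) :
    ∃ C, 0 ≤ C ∧ ∀ z, ‖F z‖ ≤ C * Real.exp (β * ‖z‖ ^ 2 / 2) := by
  have hInt' := (ENNReal.ofReal_toReal hInt.ne).ge
  obtain ⟨C, hC, h⟩ : ∃ C, 0 ≤ C ∧ ∀ z, ‖F z‖ ≤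
      C * ((‖z‖ + 1) ^ 4 * Real.exp (α * (‖z‖ + 1) ^ 2 / 2)) := by
    rcases le_or_gt 1 p with h1 | h1
    · exact exists_norm_le_of_one_le hF h1 hα ENNReal.toReal_nonneg hInt'
    · exact exists_norm_le_of_lt_one hF hp h1 hα ENNReal.toReal_nonneg hInt'
  set δ := β - α with hδ
  have hδ0 : 0 < δ := sub_pos.2 hβ
  refine ⟨C * (24 * Real.exp (1 + α / 2 + (α + 1) ^ 2 / (2 * δ))), by positivity, fun z => ?_⟩
  refine (h z).trans ?_
  rw [mul_assoc]
  refine mul_le_mul_of_nonneg_left ?_ hC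
  have h1 : (‖z‖ + 1) ^ 4 ≤ 24 * Real.exp (‖z‖ + 1) := by
    have := Real.pow_div_factorial_le_exp (‖z‖ + 1) (by positivity) 4
    rw [div_le_iff₀ (by positivity)] at this
    calc _ ≤ _ := this
      _ = _ := by norm_num [Nat.factorial]; ring
  calc _ ≤ 24 * Real.exp (‖z‖ + 1) * Real.exp (α * (‖z‖ + 1) ^ 2 / 2) := by gcongr
    _ = 24 * Real.exp (‖z‖ + 1 + α * (‖z‖ + 1) ^ 2 / 2) := by rw [mul_assoc, ← Real.exp_add]
    _ ≤ 24 * Real.exp (1 + α / 2 + (α + 1) ^ 2 / (2 * δ) + β * ‖z‖ ^ 2 / 2) := by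
        refine mul_le_mul_of_nonneg_left (Real.exp_le_exp.2 ?_) (by norm_num)
        -- The terms linear in `‖z‖`, from the polynomial factor and from the shift by `1`, are
        -- absorbed by the gap `δ = β - α` on completing the square.
        have h2 : (α + 1) * ‖z‖ ≤ (α + 1) ^ 2 / (2 * δ) + δ * ‖z‖ ^ 2 / 2 := by
          have h3 : (α + 1) ^ 2 / (2 * δ) + δ * ‖z‖ ^ 2 / 2 - (α + 1) * ‖z‖
              = (δ * ‖z‖ - (α + 1)) ^ 2 / (2 * δ) := by
            field_simp; ring
          have : 0 ≤ (δ * ‖z‖ - (α + 1)) ^ 2 / (2 * δ) := by positivity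
          linarith
        have h3 : β = δ + α := by rw [hδ]; ring
        rw [h3]
        linarith
    _ = _ := by rw [Real.exp_add (1 + α / 2 + (α + 1) ^ 2 / (2 * δ)), mul_assoc]

end Growth

/-! ### Slices, the global power series and the representation formula. -/

section Slices

/-- The real line lies in every slice, so reading Taylor coefficients off it makes them independent
of the slice. -/
theorem iteratedDeriv_comp_ofReal {E : Type*} [NormedAddCommGroup E] [NormedSpace ℝ E]
    [NormedSpace ℂ E] [IsScalarTower ℝ ℂ E] [CompleteSpace E] (n : ℕ) :
    ∀ {F : ℂ → E}, Differentiable ℂ F → ∀ x : ℝ,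
      iteratedDeriv n (fun t : ℝ => F t) x = iteratedDeriv n F x := by
  induction n with
  | zero => intro F _ x; simp
  | succ n ih =>
    intro F hF x
    have h : (deriv fun t : ℝ => F t) = fun t : ℝ => deriv F t := by
      funext t
      have := (hF t).hasDerivAt.scomp t Complex.ofRealCLM.hasDerivAt
      simpa [Function.comp_def] using this.deriv
    rw [iteratedDeriv_succ', iteratedDeriv_succ', h]
    exact ih hF.deriv x

theorem imagSphere_mul_self {I : ℍ} (hI : I ∈ imagSphere) : I * I = -1 := by
  have h1 : star I = -I := Quaternion.star_eq_neg.2 hI.1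
  have h2 := Quaternion.self_mul_star I
  rw [h1, Quaternion.normSq_eq_norm_mul_self, hI.2] at h2
  have h3 : I * I = -(I * -I) := by simp
  rw [h3, h2]
  simp

/-- The embedding of `ℂ` onto the slice `ℂ_I`. -/
noncomputable def sliceHom (I : imagSphere) : ℂ →ₐ[ℝ] ℍ :=
  Complex.liftAux (I : ℍ) (imagSphere_mul_self I.2)

theorem sliceHom_apply (I : imagSphere) (z : ℂ) : sliceHom I z = slicePoint I z.re z.im := by
  rw [sliceHom, Complex.liftAux_apply, slicePoint, Quaternion.mul_coe_eq_smul]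
  rfl

theorem sliceHom_ofReal (I : imagSphere) (x : ℝ) : sliceHom I x = (x : ℍ) := by
  rw [sliceHom_apply]
  simp [slicePoint]

theorem sliceHom_I (I : imagSphere) : sliceHom I Complex.I = I := by
  rw [sliceHom_apply]
  simp [slicePoint]

theorem normSq_slicePoint {I : ℍ} (hI : I ∈ imagSphere) (x y : ℝ) :
    ‖slicePoint I x y‖ ^ 2 = x ^ 2 + y ^ 2 := by
  have h := hI.2
  have h2 : ‖I‖ * ‖I‖ = 1 := by rw [h]; norm_num
  rw [← Quaternion.normSq_eq_norm_mul_self, Quaternion.normSq_def', hI.1] at h2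
  rw [pow_two, ← Quaternion.normSq_eq_norm_mul_self, Quaternion.normSq_def', slicePoint,
    Quaternion.mul_coe_eq_smul]
  simp [hI.1]
  linear_combination y ^ 2 * h2

theorem norm_sliceHom (I : imagSphere) (z : ℂ) : ‖sliceHom I z‖ = ‖z‖ := by
  have h : ‖sliceHom I z‖ ^ 2 = ‖z‖ ^ 2 := by
    rw [sliceHom_apply, normSq_slicePoint I.2, Complex.sq_norm, Complex.normSq_apply]
    ring
  exact (pow_left_inj₀ (norm_nonneg _) (norm_nonneg _) two_ne_zero).1 h

/-- `ℍ` as a complex vector space, the imaginary unit acting by left multiplication by `I`. -/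
noncomputable abbrev sliceNormedSpace (I : imagSphere) : NormedSpace ℂ ℍ :=
  { Module.compHom ℍ (sliceHom I).toRingHom with
    norm_smul_le := fun z q => by
      change ‖sliceHom I z * q‖ ≤ ‖z‖ * ‖q‖
      rw [norm_mul, norm_sliceHom] }

theorem isScalarTower_slice (I : imagSphere) :
    letI := sliceNormedSpace I
    IsScalarTower ℝ ℂ ℍ := by
  let := sliceNormedSpace I
  refine ⟨fun x z q => ?_⟩
  change sliceHom I (x • z) * q = x • (sliceHom I z * q)
  rw [map_smul, smul_mul_assoc]

theorem differentiable_slice (I : imagSphere) {f : ℍ → ℍ} (hf : IsEntireSliceRegular f) :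
    letI := sliceNormedSpace I
    Differentiable ℂ fun z : ℂ => f (sliceHom I z) := by
  let := sliceNormedSpace I
  have := isScalarTower_slice I
  intro z
  set L : ℂ →L[ℝ] ℍ := LinearMap.toContinuousLinearMap (sliceHom I).toLinearMap with hL
  have hLa : ∀ w, L w = sliceHom I w := fun w => rfl
  have hd : HasFDerivAt (fun z : ℂ => f (sliceHom I z)) ((fderiv ℝ f (sliceHom I z)).comp L) z :=
    (hf.1 (sliceHom I z)).hasFDerivAt.comp z L.hasFDerivAt
  set D := (fderiv ℝ f (sliceHom I z)).comp L with hD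
  have hx : HasDerivAt (fun t : ℝ => f (slicePoint I t z.im)) (D 1) z.re := by
    have hline : HasDerivAt (fun t : ℝ => (t : ℂ) + z.im * Complex.I) 1 z.re := by
      simpa using Complex.ofRealCLM.hasDerivAt.add_const (z.im * Complex.I)
    have hz : (z.re : ℂ) + z.im * Complex.I = z := Complex.re_add_im z
    have := HasFDerivAt.comp_hasDerivAt z.re (hz.symm ▸ hd) hline
    refine this.congr_of_eventuallyEq (Eventually.of_forall fun t => ?_)
    simp [sliceHom_apply]
  have hy : HasDerivAt (fun t : ℝ => f (slicePoint I z.re t)) (D Complex.I) z.im := by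
    have hline : HasDerivAt (fun t : ℝ => (z.re : ℂ) + t * Complex.I) Complex.I z.im := by
      simpa using ((Complex.ofRealCLM.hasDerivAt (x := z.im)).mul_const Complex.I).const_add
        (z.re : ℂ)
    have hz : (z.re : ℂ) + z.im * Complex.I = z := Complex.re_add_im z
    have := HasFDerivAt.comp_hasDerivAt z.im (hz.symm ▸ hd) hline
    refine this.congr_of_eventuallyEq (Eventually.of_forall fun t => ?_)
    simp [sliceHom_apply]
  -- The slice equation is the Cauchy–Riemann equation: it makes the real differential complex
  -- linear for left multiplication by `I`.
  have hCR : D Complex.I = I * D 1 := by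
    have h := hf.2 I I.2 z.re z.im
    rw [sliceDbar, hx.deriv, hy.deriv] at h
    have h' : D 1 + I * D Complex.I = 0 := by
      rcases smul_eq_zero.1 h with h | h
      · norm_num at h
      · exact h
    have h'' : (I : ℍ) * (D 1 + I * D Complex.I) = 0 := by rw [h', mul_zero]
    rw [mul_add, ← mul_assoc, imagSphere_mul_self I.2, neg_one_mul] at h''
    exact (sub_eq_zero.1 ((sub_eq_add_neg _ _).trans h'')).symm
  refine ⟨ContinuousLinearMap.toSpanSingleton ℂ (D 1), ?_⟩
  refine hasFDerivAt_of_restrictScalars ℝ hd ?_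
  refine ContinuousLinearMap.ext fun w => ?_
  have hw : w = w.re • (1 : ℂ) + w.im • Complex.I := by
    simp
  change sliceHom I w * D 1 = D w
  conv_rhs => rw [hw, map_add, map_smul, map_smul, hCR]
  rw [sliceHom_apply, slicePoint, add_mul, Quaternion.coe_mul_eq_smul, Quaternion.mul_coe_eq_smul,
    smul_mul_assoc]

/-- The Taylor coefficients at the origin of the restriction of `f` to the real line. -/
noncomputable def sliceCoeff (f : ℍ → ℍ) (n : ℕ) : ℍ :=
  (n.factorial : ℝ)⁻¹ • iteratedDeriv n (fun x : ℝ => f (x : ℍ)) 0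

theorem iteratedDeriv_slice (I : imagSphere) {f : ℍ → ℍ} (hf : IsEntireSliceRegular f) (n : ℕ) :
    letI := sliceNormedSpace I
    iteratedDeriv n (fun z : ℂ => f (sliceHom I z)) 0 =
      iteratedDeriv n (fun x : ℝ => f (x : ℍ)) 0 := by
  let := sliceNormedSpace I
  have := isScalarTower_slice I
  have h := iteratedDeriv_comp_ofReal n (differentiable_slice I hf) 0
  simp only [sliceHom_ofReal] at h
  rw [h, Complex.ofReal_zero]

theorem hasSum_slice (I : imagSphere) {f : ℍ → ℍ} (hf : IsEntireSliceRegular f) (z : ℂ) :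
    HasSum (fun n => sliceHom I z ^ n * sliceCoeff f n) (f (sliceHom I z)) := by
  let := sliceNormedSpace I
  have := isScalarTower_slice I
  have h := Complex.hasSum_taylorSeries_of_entire (differentiable_slice I hf) 0 z
  have hterm : (fun n => sliceHom I z ^ n * sliceCoeff f n) = fun n : ℕ =>
      (n.factorial : ℂ)⁻¹ • (z - 0) ^ n • iteratedDeriv n (fun z : ℂ => f (sliceHom I z)) 0 := by
    funext n
    rw [iteratedDeriv_slice I hf]
    change _ = sliceHom I (n.factorial : ℂ)⁻¹ * (sliceHom I ((z - 0) ^ n) * _)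
    have hc : ((n.factorial : ℂ)⁻¹) = (((n.factorial : ℝ)⁻¹ : ℝ) : ℂ) := by push_cast; rfl
    rw [hc, sliceHom_ofReal, Quaternion.coe_mul_eq_smul, sub_zero, map_pow, sliceCoeff,
      mul_smul_comm]
  rw [hterm]
  exact h

/-- The imaginary unit `i`, as a point of `𝕊`. -/
noncomputable def imagUnit : imagSphere :=
  ⟨Quaternion.coeComplex Complex.I, by simp, by
    have h : ‖Quaternion.coeComplex Complex.I‖ * ‖Quaternion.coeComplex Complex.I‖ = 1 := by
      rw [← Quaternion.normSq_eq_norm_mul_self, Quaternion.normSq_def']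
      simp
    nlinarith [norm_nonneg (Quaternion.coeComplex Complex.I)]⟩

theorem exists_sliceHom_eq (q : ℍ) : ∃ J : imagSphere, sliceHom J ⟨q.re, ‖q.im‖⟩ = q := by
  rcases eq_or_ne q.im 0 with h | h
  · refine ⟨imagUnit, ?_⟩
    rw [sliceHom_apply, slicePoint, h, norm_zero]
    conv_rhs => rw [← Quaternion.re_add_im q, h]
    simp
  · have hn : ‖q.im‖ ≠ 0 := norm_ne_zero_iff.2 h
    refine ⟨⟨‖q.im‖⁻¹ • q.im, by simp, ?_⟩, ?_⟩
    · rw [norm_smul, norm_inv, norm_norm, inv_mul_cancel₀ hn]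
    · rw [sliceHom_apply, slicePoint, Quaternion.mul_coe_eq_smul, smul_smul,
        mul_inv_cancel₀ hn, one_smul]
      exact Quaternion.re_add_im q

theorem star_sliceHom (J : imagSphere) (z : ℂ) :
    star (sliceHom J z) = sliceHom J (starRingEnd ℂ z) := by
  rw [sliceHom_apply, sliceHom_apply, slicePoint, slicePoint, Quaternion.mul_coe_eq_smul,
    Quaternion.mul_coe_eq_smul]
  have h1 : star (J : ℍ) = -J := Quaternion.star_eq_neg.2 J.2.1
  simp [h1]

theorem hasSum_of_isEntireSliceRegular {f : ℍ → ℍ} (hf : IsEntireSliceRegular f) (q : ℍ) :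
    HasSum (fun n => q ^ n * sliceCoeff f n) (f q) := by
  obtain ⟨J, hJ⟩ := exists_sliceHom_eq q
  have := hasSum_slice J hf ⟨q.re, ‖q.im‖⟩
  rwa [hJ] at this

/-- The representation formula: the values on one slice determine those on every other slice. -/
theorem slice_representation (I J : imagSphere) {f : ℍ → ℍ} (hf : IsEntireSliceRegular f) (z : ℂ) :
    f (sliceHom I z) =
      (1 / 2 : ℝ) • (f (sliceHom J z) + f (sliceHom J (starRingEnd ℂ z))) -
      (1 / 2 : ℝ) • ((I * J : ℍ) *
        (f (sliceHom J z) - f (sliceHom J (starRingEnd ℂ z)))) := by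
  have h1 := hasSum_slice J hf z
  have h2 := hasSum_slice J hf (starRingEnd ℂ z)
  have h3 := ((h1.add h2).const_smul (1 / 2 : ℝ)).sub
    (((h1.sub h2).mul_left (I * J : ℍ)).const_smul (1 / 2 : ℝ))
  -- Both sides are series with the same right coefficients, so it suffices to compare the left
  -- factors. With `w = z ^ n` the right side gives `Re w - I J (Im w · J)`, which is `Re w + I Im
  -- w` because `J² = -1`.
  refine (hasSum_slice I hf z).unique ?_
  refine Eq.subst (motive := fun g => HasSum g _) (funext fun n => Eq.symm ?_) h3
  rw [← map_pow, ← map_pow, ← map_pow, ← map_pow, ← add_mul, ← sub_mul, ← mul_assoc,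
    ← smul_mul_assoc, ← smul_mul_assoc, ← sub_mul]
  congr 1
  set w := z ^ n
  have hJJ := imagSphere_mul_self J.2
  simp only [sliceHom_apply, slicePoint, Quaternion.mul_coe_eq_smul, Complex.conj_re,
    Complex.conj_im, neg_smul]
  have e1 : ((w.re : ℍ) + w.im • (J : ℍ)) + ((w.re : ℍ) + -(w.im • (J : ℍ))) =
      (2 : ℝ) • (w.re : ℍ) := by rw [two_smul]; abel
  have e2 : ((w.re : ℍ) + w.im • (J : ℍ)) - ((w.re : ℍ) + -(w.im • (J : ℍ))) =
      (2 : ℝ) • (w.im • (J : ℍ)) := by rw [two_smul]; abel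
  rw [e1, e2, mul_smul_comm, mul_smul_comm, mul_assoc, hJJ, smul_smul, smul_smul]
  simp

theorem norm_slice_le (I J : imagSphere) {f : ℍ → ℍ} (hf : IsEntireSliceRegular f) (z : ℂ) :
    ‖f (sliceHom I z)‖ ≤ ‖f (sliceHom J z)‖ + ‖f (sliceHom J (starRingEnd ℂ z))‖ := by
  rw [slice_representation I J hf z]
  have hI : ‖(I : ℍ)‖ = 1 := I.2.2
  have hJ : ‖(J : ℍ)‖ = 1 := J.2.2
  refine (norm_sub_le _ _).trans ?_
  rw [norm_smul, norm_smul, norm_mul, norm_mul, hI, hJ]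
  have h1 := norm_add_le (f (sliceHom J z)) (f (sliceHom J (starRingEnd ℂ z)))
  have h2 := norm_sub_le (f (sliceHom J z)) (f (sliceHom J (starRingEnd ℂ z)))
  norm_num
  linarith

end Slices

/-! ### Integration over `ℍ` and over a slice. -/

section Integrals

/-- Polar coordinates, used in dimension `3` for the imaginary part of a quaternion and in dimension
`1` for the imaginary part of a complex number. Both lead to the same half-plane integral with
density `y²`. -/
theorem lintegral_fun_norm_addHaar {E : Type*} [NormedAddCommGroup E] [NormedSpace ℝ E]
    [Nontrivial E] [MeasurableSpace E] [FiniteDimensional ℝ E] [BorelSpace E] (μ : Measure E)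
    [μ.IsAddHaarMeasure] {g : ℝ → ℝ≥0∞} (hg : Measurable g) :
    ∫⁻ x, g ‖x‖ ∂μ = μ.toSphere Set.univ *
      ∫⁻ y in Set.Ioi (0 : ℝ), ENNReal.ofReal (y ^ (Module.finrank ℝ E - 1)) * g y :=
  calc
    ∫⁻ x, g ‖x‖ ∂μ = ∫⁻ x : ({(0)}ᶜ : Set E), g ‖x.1‖ ∂(μ.comap (↑)) := by
      rw [lintegral_subtype_comap (measurableSet_singleton _).compl fun x => g ‖x‖,
        restrict_compl_singleton]
    _ = ∫⁻ x, g x.2 ∂μ.toSphere.prod (.volumeIoiPow (Module.finrank ℝ E - 1)) := by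
      simpa using μ.measurePreserving_homeomorphUnitSphereProd.lintegral_comp_emb
        (Homeomorph.measurableEmbedding _) (g ∘ Subtype.val ∘ Prod.snd)
    _ = μ.toSphere Set.univ *
        ∫⁻ x : Set.Ioi (0 : ℝ), g x ∂.volumeIoiPow (Module.finrank ℝ E - 1) := by
      rw [lintegral_prod _ (by fun_prop)]
      simp only [lintegral_const]
      rw [mul_comm]
    _ = _ := by
      rw [Measure.volumeIoiPow, lintegral_withDensity_eq_lintegral_mul _ (by fun_prop)
        (by fun_prop)]
      simp only [Pi.mul_apply]
      rw [lintegral_subtype_comap measurableSet_Ioi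
        fun a => ENNReal.ofReal (a ^ (Module.finrank ℝ E - 1)) * g a]

/-- The splitting of a quaternion into its real and its imaginary part. -/
noncomputable def reImProd (q : ℍ) : ℝ × EuclideanSpace ℝ (Fin 3) :=
  (q.re, WithLp.toLp 2 ![q.imI, q.imJ, q.imK])

theorem measurePreserving_reImProd : MeasurePreserving reImProd := by
  have h1 := (PiLp.volume_preserving_ofLp (Fin 4)).comp measurePreserving_linearIsometryEquivTuple
  have h2 := (volume_preserving_piFinSuccAbove (fun _ : Fin 4 => ℝ) 0).comp h1
  have h3 := ((MeasurePreserving.id (volume : Measure ℝ)).prod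
    (PiLp.volume_preserving_toLp (Fin 3))).comp h2
  exact h3

theorem norm_reImProd_snd (q : ℍ) : ‖(reImProd q).2‖ = ‖q.im‖ := by
  have h : ‖(reImProd q).2‖ ^ 2 = ‖q.im‖ ^ 2 := by
    rw [pow_two ‖q.im‖, ← Quaternion.normSq_eq_norm_mul_self, Quaternion.normSq_def',
      EuclideanSpace.norm_sq_eq]
    simp [reImProd, Fin.sum_univ_three]
  exact (pow_left_inj₀ (norm_nonneg _) (norm_nonneg _) two_ne_zero).1 h

theorem lintegral_re_norm_im {G : ℝ × ℝ → ℝ≥0∞} (hG : Measurable G) :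
    ∫⁻ q : ℍ, G (q.re, ‖q.im‖) =
      (volume : Measure (EuclideanSpace ℝ (Fin 3))).toSphere Set.univ *
        ∫⁻ x : ℝ, ∫⁻ y in Set.Ioi (0 : ℝ), ENNReal.ofReal (y ^ 2) * G (x, y) := by
  have h1 : ∫⁻ q : ℍ, G (q.re, ‖q.im‖) =
      ∫⁻ u : ℝ × EuclideanSpace ℝ (Fin 3), G (u.1, ‖u.2‖) := by
    rw [← measurePreserving_reImProd.lintegral_comp (f := fun u => G (u.1, ‖u.2‖)) (by fun_prop)]
    simp only [norm_reImProd_snd]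
    rfl
  rw [h1, Measure.volume_eq_prod, lintegral_prod _ (by fun_prop)]
  have h2 : ∀ x : ℝ, ∫⁻ v : EuclideanSpace ℝ (Fin 3), G (x, ‖v‖) =
      (volume : Measure (EuclideanSpace ℝ (Fin 3))).toSphere Set.univ *
        ∫⁻ y in Set.Ioi (0 : ℝ), ENNReal.ofReal (y ^ 2) * G (x, y) := fun x => by
    rw [lintegral_fun_norm_addHaar volume (g := fun y => G (x, y)) (by fun_prop)]
    simp
  simp only [h2]
  rw [lintegral_const_mul']
  exact measure_ne_top _ _

theorem lintegral_im_sq_mul_abs {G : ℝ × ℝ → ℝ≥0∞} (hG : Measurable G) :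
    ∫⁻ z : ℂ, ENNReal.ofReal (z.im ^ 2) * G (z.re, |z.im|) =
      (volume : Measure ℝ).toSphere Set.univ *
        ∫⁻ x : ℝ, ∫⁻ y in Set.Ioi (0 : ℝ), ENNReal.ofReal (y ^ 2) * G (x, y) := by
  have h1 : ∫⁻ z : ℂ, ENNReal.ofReal (z.im ^ 2) * G (z.re, |z.im|) =
      ∫⁻ u : ℝ × ℝ, ENNReal.ofReal (u.2 ^ 2) * G (u.1, |u.2|) := by
    rw [← Complex.volume_preserving_equiv_real_prod.lintegral_comp
      (f := fun u => ENNReal.ofReal (u.2 ^ 2) * G (u.1, |u.2|)) (by fun_prop)]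
    rfl
  rw [h1, Measure.volume_eq_prod, lintegral_prod _ (by fun_prop)]
  have h2 : ∀ x : ℝ, ∫⁻ y : ℝ, ENNReal.ofReal (y ^ 2) * G (x, |y|) =
      (volume : Measure ℝ).toSphere Set.univ *
        ∫⁻ y in Set.Ioi (0 : ℝ), ENNReal.ofReal (y ^ 2) * G (x, y) := fun x => by
    have := lintegral_fun_norm_addHaar (volume : Measure ℝ)
      (g := fun y => ENNReal.ofReal (y ^ 2) * G (x, y)) (by fun_prop)
    simpa using this
  simp only [h2]
  rw [lintegral_const_mul']
  exact measure_ne_top _ _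

theorem measurePreserving_star : MeasurePreserving (star : ℍ → ℍ) := by
  let L : ℍ →ₗ[ℝ] ℍ :=
    { toFun := star
      map_add' := star_add
      map_smul' := fun r q => by simp }
  let e : ℍ ≃ₗᵢ[ℝ] ℍ :=
    { LinearEquiv.ofInvolutive L star_involutive with
      norm_map' := fun q => Quaternion.norm_star q }
  exact e.measurePreserving

theorem add_rpow_le {a b p : ℝ} (ha : 0 ≤ a) (hb : 0 ≤ b) (hp : 0 ≤ p) :
    (a + b) ^ p ≤ 2 ^ p * (a ^ p + b ^ p) := by
  have h1 : a + b ≤ 2 * max a b := by linarith [le_max_left a b, le_max_right a b]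
  calc (a + b) ^ p ≤ (2 * max a b) ^ p := Real.rpow_le_rpow (by positivity) h1 hp
    _ = 2 ^ p * (max a b) ^ p := Real.mul_rpow (by norm_num) (le_max_of_le_left ha)
    _ ≤ _ := by
      gcongr
      rcases max_choice a b with h | h <;> rw [h]
      · exact le_add_of_nonneg_right (by positivity)
      · exact le_add_of_nonneg_left (by positivity)

/-- The integrand of `fockNormPow`. -/
noncomputable def fockDensity (p α : ℝ) (f : ℍ → ℍ) (q : ℍ) : ℝ :=
  ‖f q‖ ^ p * (Real.exp (-α * ‖q‖ ^ 2 / 2)) ^ p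

theorem fockDensity_nonneg (p α : ℝ) (f : ℍ → ℍ) (q : ℍ) : 0 ≤ fockDensity p α f q := by
  unfold fockDensity
  positivity

theorem continuous_fockDensity {p α : ℝ} (hp : 0 < p) {f : ℍ → ℍ} (hf : Continuous f) :
    Continuous (fockDensity p α f) := by
  unfold fockDensity
  refine (hf.norm.rpow_const fun _ => Or.inr hp.le).mul (Continuous.rpow_const ?_ fun _ =>
    Or.inr hp.le)
  fun_prop

theorem fockNormPow_lt_top_iff {p α : ℝ} (hp : 0 < p) (hα : 0 < α) {f : ℍ → ℍ} :
    fockNormPow p α f < ∞ ↔ ∫⁻ q, ENNReal.ofReal (fockDensity p α f q) < ∞ := by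
  have hpi := Real.pi_pos
  have h0 : ENNReal.ofReal ((α * p / (2 * Real.pi)) ^ 2) ≠ 0 := by
    rw [ne_eq, ENNReal.ofReal_eq_zero, not_le]
    positivity
  refine ⟨fun h => ?_, fun h => ENNReal.mul_lt_top ENNReal.ofReal_lt_top h⟩
  exact ENNReal.lt_top_of_mul_ne_top_right h.ne h0

/-- A finite integral over `ℍ` says nothing directly about one slice, which is a null set. The
representation formula bounds `f` on `ℂ_I` by its values at `q` and `star q` on any other slice, and
integrating over all slices gives the claim. -/
theorem lintegral_slice_lt_top (I : imagSphere) {p α : ℝ} (hp : 0 < p) {f : ℍ → ℍ}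
    (hf : IsEntireSliceRegular f) (hfin : ∫⁻ q, ENNReal.ofReal (fockDensity p α f q) < ∞) :
    ∫⁻ w : ℂ, ENNReal.ofReal
      (w.im ^ 2 * (‖f (sliceHom I w)‖ ^ p * (Real.exp (-α * ‖w‖ ^ 2 / 2)) ^ p)) < ∞ := by
  have hfc : Continuous f := hf.1.continuous
  have hsc : Continuous (sliceHom I) :=
    (LinearMap.toContinuousLinearMap (sliceHom I).toLinearMap).continuous
  have hden : ∀ w : ℂ, ‖f (sliceHom I w)‖ ^ p * (Real.exp (-α * ‖w‖ ^ 2 / 2)) ^ p =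
      fockDensity p α f (sliceHom I w) := fun w => by rw [fockDensity, norm_sliceHom]
  -- Adding the two conjugate points gives a function of `(x, |y|)` alone, which makes sense both on
  -- `ℂ` and, through `(q.re, ‖q.im‖)`, on `ℍ`.
  set G : ℝ × ℝ → ℝ≥0∞ := fun u =>
    ENNReal.ofReal (fockDensity p α f (sliceHom I ⟨u.1, u.2⟩)) +
    ENNReal.ofReal (fockDensity p α f (sliceHom I ⟨u.1, -u.2⟩)) with hG
  have hdc := continuous_fockDensity (α := α) hp hfc
  have hGm : Measurable G := by
    have e1 : Continuous fun u : ℝ × ℝ => (⟨u.1, u.2⟩ : ℂ) := by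
      simp only [Complex.mk_eq_add_mul_I]
      fun_prop
    have e2 : Continuous fun u : ℝ × ℝ => (⟨u.1, -u.2⟩ : ℂ) := by
      simp only [Complex.mk_eq_add_mul_I]
      fun_prop
    exact (ENNReal.measurable_ofReal.comp (hdc.comp (hsc.comp e1)).measurable).add
      (ENNReal.measurable_ofReal.comp (hdc.comp (hsc.comp e2)).measurable)
  have h1 : ∫⁻ w : ℂ, ENNReal.ofReal
      (w.im ^ 2 * (‖f (sliceHom I w)‖ ^ p * (Real.exp (-α * ‖w‖ ^ 2 / 2)) ^ p)) ≤
      ∫⁻ z : ℂ, ENNReal.ofReal (z.im ^ 2) * G (z.re, |z.im|) := by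
    refine lintegral_mono fun w => ?_
    rw [hden, ENNReal.ofReal_mul (sq_nonneg _)]
    refine mul_le_mul_right ?_ _
    simp only [hG]
    rcases abs_choice w.im with h | h <;> rw [h]
    · exact le_add_of_nonneg_right zero_le
    · rw [neg_neg]
      exact le_add_of_nonneg_left zero_le
  have hpt : ∀ q : ℍ, G (q.re, ‖q.im‖) ≤ ENNReal.ofReal (2 * 2 ^ p) *
      (ENNReal.ofReal (fockDensity p α f q) + ENNReal.ofReal (fockDensity p α f (star q))) := by
    intro q
    obtain ⟨J, hJ⟩ := exists_sliceHom_eq q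
    set z : ℂ := ⟨q.re, ‖q.im‖⟩ with hz
    have hzc : (⟨q.re, -‖q.im‖⟩ : ℂ) = starRingEnd ℂ z := rfl
    have hJ' : sliceHom J (starRingEnd ℂ z) = star q := by rw [← star_sliceHom, hJ]
    have hq : ‖z‖ = ‖q‖ := by rw [← hJ, norm_sliceHom]
    have b1 := norm_slice_le I J hf z
    have b2 := norm_slice_le I J hf (starRingEnd ℂ z)
    rw [Complex.conj_conj, hJ, hJ', add_comm] at b2
    rw [hJ, hJ'] at b1
    have key : ∀ w : ℂ, ‖w‖ = ‖q‖ → ‖f (sliceHom I w)‖ ≤ ‖f q‖ + ‖f (star q)‖ →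
        fockDensity p α f (sliceHom I w) ≤
          2 ^ p * (fockDensity p α f q + fockDensity p α f (star q)) := fun w hw hle => by
      simp only [fockDensity, norm_sliceHom, hw, Quaternion.norm_star]
      rw [← add_mul, ← mul_assoc]
      gcongr
      exact (Real.rpow_le_rpow (norm_nonneg _) hle hp.le).trans
        (add_rpow_le (norm_nonneg _) (norm_nonneg _) hp.le)
    have k1 := key z hq b1
    have k2 := key (starRingEnd ℂ z) (by rw [Complex.norm_conj, hq]) b2
    have n1 := fockDensity_nonneg p α f q
    have n2 := fockDensity_nonneg p α f (star q)
    simp only [hG]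
    rw [hzc, ← ENNReal.ofReal_add (fockDensity_nonneg _ _ _ _) (fockDensity_nonneg _ _ _ _),
      ← ENNReal.ofReal_add n1 n2, ← ENNReal.ofReal_mul (by positivity)]
    apply ENNReal.ofReal_le_ofReal
    linarith
  have h2 : ∫⁻ q : ℍ, G (q.re, ‖q.im‖) < ∞ := by
    refine (lintegral_mono hpt).trans_lt ?_
    have hm : Measurable fun q => ENNReal.ofReal (fockDensity p α f q) :=
      ENNReal.measurable_ofReal.comp hdc.measurable
    rw [lintegral_const_mul' _ _ ENNReal.ofReal_ne_top, lintegral_add_left hm,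
      measurePreserving_star.lintegral_comp hm]
    exact ENNReal.mul_lt_top ENNReal.ofReal_lt_top (ENNReal.add_lt_top.2 ⟨hfin, hfin⟩)
  rw [lintegral_re_norm_im hGm] at h2
  refine h1.trans_lt ?_
  rw [lintegral_im_sq_mul_abs hGm]
  refine ENNReal.mul_lt_top (measure_lt_top _ _) (ENNReal.lt_top_of_mul_ne_top_right h2.ne ?_)
  rw [ne_eq, Measure.measure_univ_eq_zero]
  exact Measure.toSphere_ne_zero _

end Integrals

/-! ### Gaussian bounds and membership of polynomials. -/

section Polynomials

theorem lintegral_exp_neg_mul_sq_lt_top {b : ℝ} (hb : 0 < b) :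
    ∫⁻ q : ℍ, ENNReal.ofReal (Real.exp (-b * ‖q‖ ^ 2)) < ∞ := by
  have h := (GaussianFourier.integrable_cexp_neg_mul_sq_norm_add (V := ℍ) (b := b)
    (by simpa using hb) 0 0).norm
  have h' : Integrable fun q : ℍ => Real.exp (-b * ‖q‖ ^ 2) := by
    refine h.congr (Eventually.of_forall fun q => ?_)
    simp only [Complex.norm_exp]
    congr 1
    rw [zero_mul, add_zero]
    norm_cast
  exact h'.lintegral_lt_top

theorem fockDensity_le_of_norm_le {p α β C : ℝ} (hp : 0 < p) (hC : 0 ≤ C) {f : ℍ → ℍ} {q : ℍ}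
    (h : ‖f q‖ ≤ C * Real.exp (β * ‖q‖ ^ 2 / 2)) :
    fockDensity p α f q ≤ C ^ p * Real.exp (-(p * (α - β) / 2) * ‖q‖ ^ 2) := by
  calc fockDensity p α f q
      ≤ (C * Real.exp (β * ‖q‖ ^ 2 / 2)) ^ p * (Real.exp (-α * ‖q‖ ^ 2 / 2)) ^ p := by
        unfold fockDensity
        gcongr
    _ = _ := by
        rw [Real.mul_rpow hC (by positivity), ← Real.exp_mul, ← Real.exp_mul, mul_assoc,
          ← Real.exp_add]
        congr 2
        ring

theorem lintegral_fockDensity_bound_lt_top {p α β : ℝ} (hp : 0 < p) (hβ : β < α) (C : ℝ) :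
    ∫⁻ q : ℍ, ENNReal.ofReal (C ^ p * Real.exp (-(p * (α - β) / 2) * ‖q‖ ^ 2)) < ∞ := by
  have hb : 0 < p * (α - β) / 2 := by
    have := sub_pos.2 hβ
    positivity
  simp only [ENNReal.ofReal_mul' (Real.exp_nonneg _)]
  rw [lintegral_const_mul' _ _ ENNReal.ofReal_ne_top]
  exact ENNReal.mul_lt_top ENNReal.ofReal_lt_top (lintegral_exp_neg_mul_sq_lt_top hb)

theorem pow_le_mul_exp_sq {β t : ℝ} (hβ : 0 < β) (ht : 0 ≤ t) (k : ℕ) :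
    t ^ k ≤ k.factorial * Real.exp (1 / (2 * β)) * Real.exp (β * t ^ 2 / 2) := by
  have h := Real.pow_div_factorial_le_exp t ht k
  rw [div_le_iff₀ (by positivity)] at h
  rw [mul_assoc, ← Real.exp_add, mul_comm]
  refine h.trans (mul_le_mul_of_nonneg_right (Real.exp_le_exp.2 ?_) (by positivity))
  have h3 : 1 / (2 * β) + β * t ^ 2 / 2 - t = (β * t - 1) ^ 2 / (2 * β) := by
    field_simp; ring
  have : 0 ≤ (β * t - 1) ^ 2 / (2 * β) := by positivity
  linarith

/-- On a slice `q ^ k` is the image of `z ^ k`, and coefficients on the right do not interfere with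
left multiplication by `I`; each term carries the factor `1 + I * I = 0`. -/
theorem isEntireSliceRegular_polynomial (n : ℕ) (a : ℕ → ℍ) :
    IsEntireSliceRegular fun q => ∑ k ∈ Finset.range n, q ^ k * a k := by
  refine ⟨by fun_prop, fun I hI x y => ?_⟩
  set φ := sliceHom ⟨I, hI⟩ with hφ
  set L : ℂ →L[ℝ] ℍ := LinearMap.toContinuousLinearMap φ.toLinearMap with hL
  set z : ℂ := x + y * Complex.I with hz
  have hslice : ∀ s t : ℝ, slicePoint I s t = φ (s + t * Complex.I) := fun s t => by
    rw [hφ, sliceHom_apply]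
    simp
  have hder : ∀ {γ : ℝ → ℂ} {γ' : ℂ} {t : ℝ}, HasDerivAt γ γ' t → γ t = z →
      HasDerivAt (fun s => ∑ k ∈ Finset.range n, φ (γ s) ^ k * a k)
        (∑ k ∈ Finset.range n, φ γ' * φ (k * z ^ (k - 1)) * a k) t := fun {γ γ' t} hγ hγz => by
    refine HasDerivAt.fun_sum fun k _ => HasDerivAt.mul_const ?_ _
    have h1 := L.hasFDerivAt.comp_hasDerivAt t (hγ.pow k)
    rw [hγz, mul_comm] at h1
    have h2 : L (γ' * (k * z ^ (k - 1))) = φ γ' * φ (k * z ^ (k - 1)) := map_mul φ _ _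
    rw [h2] at h1
    refine h1.congr_of_eventuallyEq (Eventually.of_forall fun s => ?_)
    exact (map_pow φ _ _).symm
  have hx := hder (γ := fun t : ℝ => (t : ℂ) + y * Complex.I) (γ' := 1) (t := x)
    (by simpa using Complex.ofRealCLM.hasDerivAt.add_const (y * Complex.I)) rfl
  have hy := hder (γ := fun t : ℝ => (x : ℂ) + t * Complex.I) (γ' := Complex.I) (t := y)
    (by
      simpa using
        ((Complex.ofRealCLM.hasDerivAt (x := y)).mul_const Complex.I).const_add (x : ℂ)) rfl
  simp only [sliceDbar, hslice]
  rw [hx.deriv, hy.deriv, Finset.mul_sum, ← Finset.sum_add_distrib, Finset.sum_eq_zero, smul_zero]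
  intro k _
  have hφI : φ Complex.I = I := sliceHom_I ⟨I, hI⟩
  rw [hφI, map_one, one_mul, ← mul_assoc, ← mul_assoc, imagSphere_mul_self hI]
  simp

theorem quaternionicPolynomials_subset_fockSpace {p α : ℝ} (hp : 0 < p) (hα : 0 < α) :
    quaternionicPolynomials ⊆ fockSpace p α := by
  rintro P ⟨n, a, hP⟩
  obtain rfl : P = fun q => ∑ k ∈ Finset.range (n + 1), q ^ k * a k := funext hP
  refine ⟨isEntireSliceRegular_polynomial _ a, (fockNormPow_lt_top_iff hp hα).2 ?_⟩
  set β := α / 2 with hβ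
  have hβ0 : 0 < β := by positivity
  have hβα : β < α := by linarith
  set C := ∑ k ∈ Finset.range (n + 1), k.factorial * Real.exp (1 / (2 * β)) * ‖a k‖ with hC
  have hC0 : 0 ≤ C := Finset.sum_nonneg fun k _ => by positivity
  refine (lintegral_mono fun q => ENNReal.ofReal_le_ofReal
    (fockDensity_le_of_norm_le hp hC0 (β := β) ?_)).trans_lt
    (lintegral_fockDensity_bound_lt_top hp hβα C)
  rw [hC, Finset.sum_mul]
  refine norm_sum_le_of_le _ fun k _ => ?_
  rw [norm_mul, norm_pow]
  calc _ ≤ k.factorial * Real.exp (1 / (2 * β)) * Real.exp (β * ‖q‖ ^ 2 / 2) * ‖a k‖ := by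
        gcongr
        exact pow_le_mul_exp_sq hβ0 (norm_nonneg q) k
    _ = _ := by ring

end Polynomials

/-! ### From pointwise convergence to convergence in mean. -/

section Convergence

/-- Convergence almost everywhere together with convergence of the `p`-th power norms implies
convergence in the mean of order `p`. -/
theorem tendsto_lintegral_of_tendsto_of_lintegral_le {X : Type*} [MeasurableSpace X]
    {μ : Measure X} {a : X → ℝ≥0∞} {a' d : ℕ → X → ℝ≥0∞} {c : ℝ≥0∞} {t : ℕ → ℝ≥0∞}
    (ha : Measurable a) (ha' : ∀ n, Measurable (a' n)) (hd : ∀ n, Measurable (d n))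
    (hc : c ≠ ∞) (hfin : ∫⁻ x, a x ∂μ ≠ ∞)
    (hle : ∀ n x, d n x ≤ c * (a' n x + a x))
    (hlim : ∀ x, Tendsto (fun n => a' n x) atTop (𝓝 (a x)))
    (hdlim : ∀ x, Tendsto (fun n => d n x) atTop (𝓝 0))
    (hInt : ∀ n, ∫⁻ x, a' n x ∂μ ≤ t n * ∫⁻ x, a x ∂μ) (ht : Tendsto t atTop (𝓝 1)) :
    Tendsto (fun n => ∫⁻ x, d n x ∂μ) atTop (𝓝 0) := by
  have hmin : Tendsto (fun n => ∫⁻ x, min (a' n x) (a x) ∂μ) atTop (𝓝 (∫⁻ x, a x ∂μ)) := by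
    refine tendsto_lintegral_of_dominated_convergence a (fun n => (ha' n).min ha)
      (fun n => Eventually.of_forall fun x => min_le_right _ _) hfin
      (Eventually.of_forall fun x => ?_)
    simpa using (hlim x).min (tendsto_const_nhds (x := a x))
  -- The subtraction is truncated, so this is the excess of `a'` over `a`, namely `a' - min a' a`.
  -- The bound on `∫ a'` and the convergence of `∫ min a' a` make it vanish in the limit.
  have hexc : Tendsto (fun n => ∫⁻ x, (a' n x - a x) ∂μ) atTop (𝓝 0) := by
    have h1 : ∀ n, ∫⁻ x, (a' n x - a x) ∂μ ≤
        t n * ∫⁻ x, a x ∂μ - ∫⁻ x, min (a' n x) (a x) ∂μ := fun n => by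
      have hm : ∫⁻ x, min (a' n x) (a x) ∂μ ≠ ∞ :=
        ((lintegral_mono fun x => min_le_right _ _).trans_lt hfin.lt_top).ne
      refine le_trans (le_of_eq ?_) (tsub_le_tsub_right (hInt n) _)
      rw [← lintegral_sub ((ha' n).min ha) hm
        (Eventually.of_forall fun x => min_le_left _ _)]
      refine lintegral_congr fun x => ?_
      rcases le_total (a' n x) (a x) with h | h
      · rw [min_eq_left h, tsub_eq_zero_of_le h, tsub_self]
      · rw [min_eq_right h]
    refine tendsto_of_tendsto_of_tendsto_of_le_of_le tendsto_const_nhds ?_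
      (fun n => zero_le) h1
    have h2 := ENNReal.Tendsto.sub (ENNReal.Tendsto.mul_const ht (Or.inr hfin)) hmin
      (Or.inl (by simpa using hfin))
    simpa using h2
  -- Once the excess is removed, `d` is dominated by the fixed integrable function `2 c a`.
  have hrest : Tendsto (fun n => ∫⁻ x, (d n x - c * (a' n x - a x)) ∂μ) atTop (𝓝 0) := by
    have h := tendsto_lintegral_of_dominated_convergence (μ := μ) (f := fun _ => 0)
      (F := fun n x => d n x - c * (a' n x - a x)) (fun x => c * (a x + a x))
      (fun n => (hd n).sub (((ha' n).sub ha).const_mul c))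
      (fun n => Eventually.of_forall fun x => ?_) ?_ (Eventually.of_forall fun x => ?_)
    · simpa using h
    · refine tsub_le_iff_right.2 ((hle n x).trans ?_)
      rw [← mul_add]
      refine mul_le_mul_right ?_ _
      calc a' n x + a x ≤ (a' n x - a x + a x) + a x := by gcongr; exact le_tsub_add
        _ = _ := by ring
    · rw [lintegral_const_mul' _ _ hc, lintegral_add_left ha]
      exact ENNReal.mul_ne_top hc (ENNReal.add_ne_top.2 ⟨hfin, hfin⟩)
    · exact tendsto_of_tendsto_of_tendsto_of_le_of_le tendsto_const_nhds (hdlim x)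
        (fun n => zero_le) fun n => tsub_le_self
  have hsum := hrest.add (ENNReal.Tendsto.const_mul hexc (Or.inr hc))
  rw [mul_zero, add_zero] at hsum
  refine tendsto_of_tendsto_of_tendsto_of_le_of_le tendsto_const_nhds hsum
    (fun n => zero_le) fun n => ?_
  have hm : Measurable fun x => c * (a' n x - a x) := ((ha' n).sub ha).const_mul c
  rw [← lintegral_const_mul' _ _ hc, ← lintegral_add_right _ hm]
  exact lintegral_mono fun x => le_tsub_add

end Convergence

/-! ### Dilation, Taylor polynomials and the diagonal choice. -/

section Density

/-- The weight at `q` is at most the weight at `r • q`, and rescaling `ℝ⁴` contributes `r⁻⁴`. -/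
theorem lintegral_fockDensity_dilate_le {p α : ℝ} (hp : 0 < p) (hα : 0 < α) {f : ℍ → ℍ}
    (hf : Continuous f) {r : ℝ} (hr0 : 0 < r) (hr1 : r ≤ 1) :
    ∫⁻ q, ENNReal.ofReal (fockDensity p α (fun q => f (r • q)) q) ≤
      ENNReal.ofReal ((r ^ 4)⁻¹) * ∫⁻ q, ENNReal.ofReal (fockDensity p α f q) := by
  have hm : Measurable fun q => ENNReal.ofReal (fockDensity p α f q) :=
    ENNReal.measurable_ofReal.comp (continuous_fockDensity hp hf).measurable
  calc _ ≤ ∫⁻ q, ENNReal.ofReal (fockDensity p α f (r • q)) := by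
        refine lintegral_mono fun q => ENNReal.ofReal_le_ofReal ?_
        simp only [fockDensity]
        gcongr ?_ * (Real.exp ?_) ^ p
        rw [norm_smul, Real.norm_eq_abs, abs_of_pos hr0, mul_pow]
        have h1 : r ^ 2 * ‖q‖ ^ 2 ≤ 1 * ‖q‖ ^ 2 := by
          gcongr
          exact pow_le_one₀ hr0.le hr1
        nlinarith
    _ = _ := by
        rw [← lintegral_map (f := fun q => ENNReal.ofReal (fockDensity p α f q)) hm
          (measurable_const_smul r), Measure.map_addHaar_smul _ hr0.ne', lintegral_smul_measure,
          Quaternion.finrank_eq_four, abs_of_pos (by positivity), smul_eq_mul]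

theorem fockDensity_add_le {p α : ℝ} (hp : 0 < p) (f g : ℍ → ℍ) (q : ℍ) :
    fockDensity p α (f + g) q ≤ 2 ^ p * (fockDensity p α f q + fockDensity p α g q) := by
  unfold fockDensity
  rw [← add_mul, ← mul_assoc]
  gcongr
  exact (Real.rpow_le_rpow (norm_nonneg _) (norm_add_le _ _) hp.le).trans
    (add_rpow_le (norm_nonneg _) (norm_nonneg _) hp.le)

theorem fockDensity_neg (p α : ℝ) (f : ℍ → ℍ) (q : ℍ) :
    fockDensity p α (-f) q = fockDensity p α f q := by
  simp [fockDensity]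

theorem tendsto_fockDensity_zero {p α : ℝ} (hp : 0 < p) {u : ℕ → ℍ → ℍ} {q : ℍ}
    (h : Tendsto (fun n => u n q) atTop (𝓝 0)) :
    Tendsto (fun n => ENNReal.ofReal (fockDensity p α (u n) q)) atTop (𝓝 0) := by
  have h1 : Tendsto (fun n => fockDensity p α (u n) q) atTop (𝓝 0) := by
    have := (h.norm.rpow_const (p := p) (Or.inr hp.le)).mul_const
      ((Real.exp (-α * ‖q‖ ^ 2 / 2)) ^ p)
    simpa [fockDensity, Real.zero_rpow hp.ne'] using this
  simpa using ENNReal.tendsto_ofReal h1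

theorem tendsto_lintegral_dilate_sub {p α : ℝ} (hp : 0 < p) (hα : 0 < α) {f : ℍ → ℍ}
    (hf : Continuous f) (hfin : ∫⁻ q, ENNReal.ofReal (fockDensity p α f q) < ∞)
    {r : ℕ → ℝ} (hr0 : ∀ n, 0 < r n) (hr1 : ∀ n, r n < 1) (hr : Tendsto r atTop (𝓝 1)) :
    Tendsto (fun n => ∫⁻ q, ENNReal.ofReal
      (fockDensity p α ((fun q => f (r n • q)) - f) q)) atTop (𝓝 0) := by
  have hcd : ∀ n, Continuous fun q => f (r n • q) := fun n => by fun_prop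
  have hm : ∀ g : ℍ → ℍ, Continuous g →
      Measurable fun q => ENNReal.ofReal (fockDensity p α g q) := fun g hg =>
    ENNReal.measurable_ofReal.comp (continuous_fockDensity hp hg).measurable
  have hlim : ∀ q, Tendsto (fun n => f (r n • q)) atTop (𝓝 (f q)) := fun q => by
    have h1 : Tendsto (fun n => r n • q) atTop (𝓝 q) := by
      simpa using hr.smul_const q
    exact (hf.tendsto q).comp h1
  refine tendsto_lintegral_of_tendsto_of_lintegral_le (c := ENNReal.ofReal (2 ^ p))
    (a := fun q => ENNReal.ofReal (fockDensity p α f q))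
    (a' := fun n q => ENNReal.ofReal (fockDensity p α (fun q => f (r n • q)) q))
    (t := fun n => ENNReal.ofReal ((r n ^ 4)⁻¹)) (hm f hf) (fun n => hm _ (hcd n))
    (fun n => hm _ ((hcd n).sub hf)) ENNReal.ofReal_ne_top hfin.ne (fun n q => ?_) (fun q => ?_)
    (fun q => ?_) (fun n => lintegral_fockDensity_dilate_le hp hα hf (hr0 n) (hr1 n).le) ?_
  · rw [← ENNReal.ofReal_add (fockDensity_nonneg _ _ _ _) (fockDensity_nonneg _ _ _ _),
      ← ENNReal.ofReal_mul (by positivity)]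
    apply ENNReal.ofReal_le_ofReal
    have := fockDensity_add_le (α := α) hp (fun q => f (r n • q)) (-f) q
    rwa [fockDensity_neg, ← sub_eq_add_neg] at this
  · apply ENNReal.tendsto_ofReal
    exact ((hlim q).norm.rpow_const (Or.inr hp.le)).mul_const _
  · apply tendsto_fockDensity_zero hp
    simpa using (hlim q).sub_const (f q)
  · have h1 : Tendsto (fun n => (r n ^ 4)⁻¹) atTop (𝓝 1) := by
      simpa using (hr.pow 4).inv₀ (by norm_num)
    simpa using ENNReal.tendsto_ofReal h1

theorem norm_sliceCoeff_mul_pow_le {p α β : ℝ} (hp : 0 < p) (hα : 0 < α) (hβ : α < β)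
    {f : ℍ → ℍ} (hf : f ∈ fockSpace p α) :
    ∃ C, 0 ≤ C ∧ ∀ (n : ℕ) (R : ℝ), 0 ≤ R →
      ‖sliceCoeff f n‖ * R ^ n ≤ C * Real.exp (β * R ^ 2 / 2) := by
  let := sliceNormedSpace imagUnit
  have hd := differentiable_slice imagUnit hf.1
  obtain ⟨C, hC, h⟩ := exists_norm_le_mul_exp hd hp hα hβ
    (lintegral_slice_lt_top imagUnit hp hf.1 ((fockNormPow_lt_top_iff hp hα).1 hf.2))
  refine ⟨C, hC, fun n R hR => ?_⟩
  have hpos : ∀ R : ℝ, 0 < R → ‖sliceCoeff f n‖ * R ^ n ≤ C * Real.exp (β * R ^ 2 / 2) := by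
    intro R hR
    have h1 := Complex.norm_iteratedDeriv_le_of_forall_mem_sphere_norm_le (c := 0) n hR
      hd.diffContOnCl (C := C * Real.exp (β * R ^ 2 / 2)) fun z hz => by
        have hz' : ‖z‖ = R := by simpa using hz
        simpa [hz'] using h z
    rw [iteratedDeriv_slice imagUnit hf.1] at h1
    rw [sliceCoeff, norm_smul, norm_inv, Real.norm_natCast]
    rw [le_div_iff₀ (by positivity)] at h1
    rw [mul_assoc, inv_mul_le_iff₀ (by positivity)]
    exact h1
  -- Cauchy's estimate needs a positive radius; letting the radius decrease to `R` includes `R = 0`.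
  refine le_of_tendsto_of_tendsto (b := 𝓝[>] R)
    (f := fun R => ‖sliceCoeff f n‖ * R ^ n) (g := fun R => C * Real.exp (β * R ^ 2 / 2)) ?_ ?_ ?_
  · exact (Continuous.tendsto (by fun_prop) R).mono_left nhdsWithin_le_nhds
  · exact (Continuous.tendsto (by fun_prop) R).mono_left nhdsWithin_le_nhds
  · filter_upwards [self_mem_nhdsWithin] with S hS
    exact hpos S (hR.trans_lt hS)

theorem tendsto_lintegral_taylor_sub_dilate {p α : ℝ} (hp : 0 < p) (hα : 0 < α) {f : ℍ → ℍ}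
    (hf : f ∈ fockSpace p α) {r : ℝ} (hr0 : 0 < r) (hr1 : r < 1) :
    Tendsto (fun N : ℕ => ∫⁻ q, ENNReal.ofReal (fockDensity p α
      ((fun q => ∑ k ∈ Finset.range (N + 1), q ^ k * (r ^ k • sliceCoeff f k)) -
        fun q => f (r • q)) q)) atTop (𝓝 0) := by
  -- Any `s` strictly between `r` and `1` would do. Coefficient bounds with exponent `α / s > α` at
  -- radius `s ‖q‖` give the exponent `α s < α`, and `r < s` leaves the geometric ratio `r / s`.
  set s := (1 + r) / 2 with hs
  have hs0 : 0 < s := by positivity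
  have hs1 : s < 1 := by linarith
  have hrs : r < s := by linarith
  obtain ⟨C, hC, hcoef⟩ := norm_sliceCoeff_mul_pow_le hp hα (β := α / s)
    (by rw [lt_div_iff₀ hs0]; nlinarith) hf
  have hβ : α * s < α := by nlinarith
  have hterm : ∀ (q : ℍ) (k : ℕ), ‖q ^ k * (r ^ k • sliceCoeff f k)‖ ≤
      C * Real.exp (α * s * ‖q‖ ^ 2 / 2) * (r / s) ^ k := fun q k => by
    rw [norm_mul, norm_pow, norm_smul, norm_pow, Real.norm_eq_abs, abs_of_pos hr0]
    have h1 := hcoef k (s * ‖q‖) (by positivity)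
    rw [show α / s * (s * ‖q‖) ^ 2 / 2 = α * s * ‖q‖ ^ 2 / 2 by field_simp] at h1
    calc _ = ‖sliceCoeff f k‖ * (s * ‖q‖) ^ k * (r / s) ^ k := by
          rw [div_pow, mul_pow]
          field_simp
      _ ≤ _ := by gcongr
  have hterm_eq : ∀ (q : ℍ) (k : ℕ), q ^ k * (r ^ k • sliceCoeff f k) =
      (r • q) ^ k * sliceCoeff f k := fun q k => by
    rw [smul_pow, smul_mul_assoc, mul_smul_comm]
  have hsum : ∀ q : ℍ, HasSum (fun k => q ^ k * (r ^ k • sliceCoeff f k)) (f (r • q)) := fun q => by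
    simp only [hterm_eq]
    exact hasSum_of_isEntireSliceRegular hf.1 (r • q)
  set K := 2 * (C * (1 - r / s)⁻¹) with hK
  have hrs1 : r / s < 1 := (div_lt_one hs0).2 hrs
  have hrs0 : 0 ≤ r / s := by positivity
  have hinv : 0 ≤ (1 - r / s)⁻¹ := inv_nonneg.2 (by linarith)
  have hK0 : 0 ≤ K := by positivity
  have hgeo := hasSum_geometric_of_lt_one hrs0 hrs1
  have hbound : ∀ (N : ℕ) (q : ℍ),
      ‖((fun q => ∑ k ∈ Finset.range (N + 1), q ^ k * (r ^ k • sliceCoeff f k)) -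
        fun q => f (r • q)) q‖ ≤ K * Real.exp (α * s * ‖q‖ ^ 2 / 2) := fun N q => by
    set M := C * Real.exp (α * s * ‖q‖ ^ 2 / 2)
    have hM : 0 ≤ M := by positivity
    have h1 : ‖f (r • q)‖ ≤ M * (1 - r / s)⁻¹ := by
      rw [← (hsum q).tsum_eq]
      exact tsum_of_norm_bounded (hgeo.mul_left M) (hterm q)
    have h2 : ‖∑ k ∈ Finset.range (N + 1), q ^ k * (r ^ k • sliceCoeff f k)‖ ≤
        M * (1 - r / s)⁻¹ := by
      refine (norm_sum_le_of_le _ fun k _ => hterm q k).trans ?_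
      exact sum_le_hasSum _ (fun k _ => by positivity) (hgeo.mul_left M)
    refine (norm_sub_le _ _).trans ((add_le_add h2 h1).trans_eq ?_)
    rw [hK]
    ring
  have hcont : ∀ N : ℕ, Continuous
      ((fun q => ∑ k ∈ Finset.range (N + 1), q ^ k * (r ^ k • sliceCoeff f k)) -
        fun q => f (r • q)) := fun N => by
    have := hf.1.1.continuous
    exact Continuous.sub (by fun_prop) (by fun_prop)
  have h := tendsto_lintegral_of_dominated_convergence (μ := (volume : Measure ℍ))
    (f := fun _ => 0)
    (F := fun N q => ENNReal.ofReal (fockDensity p α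
      ((fun q => ∑ k ∈ Finset.range (N + 1), q ^ k * (r ^ k • sliceCoeff f k)) -
        fun q => f (r • q)) q))
    (fun q => ENNReal.ofReal (K ^ p * Real.exp (-(p * (α - α * s) / 2) * ‖q‖ ^ 2)))
    (fun N => ENNReal.measurable_ofReal.comp (continuous_fockDensity hp (hcont N)).measurable)
    (fun N => Eventually.of_forall fun q => ENNReal.ofReal_le_ofReal
      (fockDensity_le_of_norm_le hp hK0 (hbound N q)))
    (lintegral_fockDensity_bound_lt_top hp hβ K).ne
    (Eventually.of_forall fun q => tendsto_fockDensity_zero hp ?_)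
  · simpa using h
  · have h1 := ((hsum q).tendsto_sum_nat.comp (tendsto_add_atTop_nat 1)).sub_const (f (r • q))
    simpa using h1

theorem exists_tendsto_fockNorm {p α : ℝ} (hp : 0 < p) (hα : 0 < α) {f : ℍ → ℍ}
    (hf : f ∈ fockSpace p α) :
    ∃ P : ℕ → ℍ → ℍ, (∀ n, P n ∈ quaternionicPolynomials) ∧
      Tendsto (fun n => fockNorm p α (P n - f)) atTop (𝓝 0) := by
  have hfin := (fockNormPow_lt_top_iff hp hα).1 hf.2
  have hfc : Continuous f := hf.1.1.continuous
  set r : ℕ → ℝ := fun n => 1 - 1 / ((n : ℝ) + 2) with hr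
  have hr0 : ∀ n, 0 < r n := fun n => by
    have : 1 / ((n : ℝ) + 2) < 1 := by
      rw [div_lt_one (by positivity)]
      linarith [Nat.cast_nonneg (α := ℝ) n]
    simpa [hr] using this
  have hr1 : ∀ n, r n < 1 := fun n => by
    have : 0 < 1 / ((n : ℝ) + 2) := by positivity
    simp only [hr]
    linarith
  have hrt : Tendsto r atTop (𝓝 1) := by
    have h1 := (tendsto_one_div_add_atTop_nhds_zero_nat (𝕜 := ℝ)).comp (tendsto_add_atTop_nat 1)
    have h2 : Tendsto (fun n : ℕ => 1 / ((n : ℝ) + 2)) atTop (𝓝 0) := by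
      refine h1.congr fun n => ?_
      simp only [Function.comp_apply, Nat.cast_add, Nat.cast_one]
      ring
    simpa [hr] using h2.const_sub 1
  -- Diagonal choice: the degree is taken large enough, depending on `r n`, for the Taylor error to
  -- be below `1 / (n + 1)`.
  have hchoice : ∀ n : ℕ, ∃ N : ℕ, ∫⁻ q, ENNReal.ofReal (fockDensity p α
      ((fun q => ∑ k ∈ Finset.range (N + 1), q ^ k * (r n ^ k • sliceCoeff f k)) -
        fun q => f (r n • q)) q) < ((n : ℝ≥0∞) + 1)⁻¹ := fun n =>
    ((tendsto_lintegral_taylor_sub_dilate hp hα hf (hr0 n) (hr1 n)).eventually_lt_const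
      (ENNReal.inv_pos.2 (by finiteness))).exists
  choose N hN using hchoice
  set P : ℕ → ℍ → ℍ := fun n q =>
    ∑ k ∈ Finset.range (N n + 1), q ^ k * (r n ^ k • sliceCoeff f k) with hP
  refine ⟨P, fun n => ⟨N n, fun k => r n ^ k • sliceCoeff f k, fun q => rfl⟩, ?_⟩
  have hPc : ∀ n, Continuous (P n) := fun n => by
    simp only [hP]
    fun_prop
  have h1 := tendsto_lintegral_dilate_sub hp hα hfc hfin hr0 hr1 hrt
  have h2 : Tendsto (fun n : ℕ => ((n : ℝ≥0∞) + 1)⁻¹) atTop (𝓝 0) := by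
    have := ENNReal.tendsto_inv_nat_nhds_zero.comp (tendsto_add_atTop_nat 1)
    refine this.congr fun n => ?_
    simp
  have h3 : Tendsto (fun n : ℕ => ENNReal.ofReal (2 ^ p) * (((n : ℝ≥0∞) + 1)⁻¹ +
      ∫⁻ q, ENNReal.ofReal (fockDensity p α ((fun q => f (r n • q)) - f) q))) atTop (𝓝 0) := by
    simpa using ENNReal.Tendsto.const_mul (h2.add h1) (Or.inr ENNReal.ofReal_ne_top)
  have h4 : Tendsto (fun n => ∫⁻ q, ENNReal.ofReal (fockDensity p α (P n - f) q))
      atTop (𝓝 0) := by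
    refine tendsto_of_tendsto_of_tendsto_of_le_of_le tendsto_const_nhds h3
      (fun n => zero_le) fun n => ?_
    have hm : Measurable fun q => ENNReal.ofReal
        (fockDensity p α (P n - fun q => f (r n • q)) q) :=
      ENNReal.measurable_ofReal.comp
        (continuous_fockDensity hp ((hPc n).sub (by fun_prop))).measurable
    calc ∫⁻ q, ENNReal.ofReal (fockDensity p α (P n - f) q)
        ≤ ∫⁻ q, ENNReal.ofReal (2 ^ p) * (ENNReal.ofReal
            (fockDensity p α (P n - fun q => f (r n • q)) q) +
            ENNReal.ofReal (fockDensity p α ((fun q => f (r n • q)) - f) q)) := by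
          refine lintegral_mono fun q => ?_
          rw [← ENNReal.ofReal_add (fockDensity_nonneg _ _ _ _) (fockDensity_nonneg _ _ _ _),
            ← ENNReal.ofReal_mul (by positivity)]
          apply ENNReal.ofReal_le_ofReal
          have := fockDensity_add_le (α := α) hp (P n - fun q => f (r n • q))
            ((fun q => f (r n • q)) - f) q
          rwa [sub_add_sub_cancel] at this
      _ = ENNReal.ofReal (2 ^ p) * ((∫⁻ q, ENNReal.ofReal
            (fockDensity p α (P n - fun q => f (r n • q)) q)) +
            ∫⁻ q, ENNReal.ofReal (fockDensity p α ((fun q => f (r n • q)) - f) q)) := by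
          rw [lintegral_const_mul' _ _ ENNReal.ofReal_ne_top, lintegral_add_left hm]
      _ ≤ _ := by
          gcongr
          exact (hN n).le
  have h5 : Tendsto (fun n => fockNormPow p α (P n - f)) atTop (𝓝 0) := by
    simpa using! ENNReal.Tendsto.const_mul (a := ENNReal.ofReal ((α * p / (2 * Real.pi)) ^ 2)) h4
      (Or.inr ENNReal.ofReal_ne_top)
  have h6 := h5.ennrpow_const (1 / p)
  rwa [ENNReal.zero_rpow_of_pos (by positivity)] at h6

end Density

end SliceFock

theorem theorem3p2 (p α : ℝ) (hp : 0 < p) (hα : 0 < α) :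
    SliceFock.quaternionicPolynomials ⊆ SliceFock.fockSpace p α ∧
    ∀ f ∈ SliceFock.fockSpace p α, ∃ P : ℕ → ℍ → ℍ,
      (∀ n, P n ∈ SliceFock.quaternionicPolynomials) ∧
      Tendsto (fun n => SliceFock.fockNorm p α (P n - f)) atTop (𝓝 0) :=
  ⟨SliceFock.quaternionicPolynomials_subset_fockSpace hp hα,
    fun _ hf => SliceFock.exists_tendsto_fockNorm hp hα hf⟩
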